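/- Let $\{Z_t\}_{t\ge 0}$ be a real, mean zero, stationary Gaussian time series with autocovariance function $\gamma_0:\mathbb Z\to\mathbb R$ and spectral density $f_0(\lambda)=\frac1{2\pi}\sum_{k\in\mathbb Z}\gamma_0(k)e^{-ik\lambda}$. Let a second real, mean zero, stationary Gaussian time series (the parametric working model) be given, with autocovariance function $\gamma_{\mathrm{param}}$, spectral density $f_{\mathrm{param}}$ (defined in the same way), and Lebesgue density $p_{\mathrm{param}}$ of its observations at times $1,\dots,n$. Assume that for each $(\gamma,f)\in\{(\gamma_0,f_0),(\gamma_{\mathrm{param}},f_{\mathrm{param}})\}$ $$\sum_{h\in\mathbb Z}|h|^{\alpha}|\gamma(h)|<\infty\ \text{ for some }\alpha>1,\qquad f(\lambda)\ge\beta\ \text{ for some }\beta>0\text{ and all }-\pi\le\lambda\le\pi ,$$ where $\alpha$ and $\beta$ may differ between the two. For $n\ge1$ put $\lambda_j=2\pi j/n$, $N=\lfloor (n-1)/2\rfloor$, $\mathbf e_j=n^{-1/2}(e^{-2\pi i jt/n})_{t=1,\dots,n}$, $\mathbf c_j=\sqrt2\,\Re\mathbf e_j$, $\mathbf s_j=\sqrt2\,\Im\mathbf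 e_j$, and let $F_n$ be the orthonormal $n\times n$ matrix with rows $\mathbf e_0,\mathbf c_1,\mathbf s_1,\dots,\mathbf c_N,\mathbf s_N$ and, if $n$ is even, the additional last row $\mathbf e_{n/2}$. With $c=f_0/f_{\mathrm{param}}$ let $C_n$ be the diagonal matrix with entries $c(\lambda_0),c(\lambda_1),c(\lambda_1),\dots,c(\lambda_N),c(\lambda_N)$ and, if $n$ is even, the additional last entry $c(\lambda_{n/2})$. Let $I_{n,\lambda}(\mathbf z)=\frac1{2\pi n}\bigl|\sum_{t=1}^n z_te^{-it\lambda}\bigr|^2$ be the periodogram. Consider the following three probability distributions on $\mathbb R^n$: 1. the true distribution $P_{n,f_0}$ of $(Z_1,\dots,Z_n)$; 2. the Whittle distribution, with Lebesgue density $$p^W(\mathbf z\mid f_0)\propto\exp\Bigl\{-\tfrac12\sum_{j=0}^{n-1}\Bigl(\log f_0(\lambda_j)+\frac{I_{n,\lambda_j}(\mathbf z)}{f_0(\lambda_j)}\Bigr)\Bigr\};$$ 3. the nonparametrically corrected parametric distribution, with Lebesgue density $$p^C_{\mathrm{param}}(\mathbf z\mid f_0)\propto\det(C_n)^{-1/2}\,p_{\mathrm{param}}\bigl(F_n^TC_n^{-1/2}F_n\mathbf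 z\bigr).$$ Then these three sequences of distributions are, as $n\to\infty$, pairwise mutually contiguous: for any two of them, $(P_n)$ and $(Q_n)$, and any measurable sets $A_n\subseteq\mathbb R^n$, one has $P_n(A_n)\to0$ if and only if $Q_n(A_n)\to0$. -/

import Mathlib

open MeasureTheory ProbabilityTheory Filter
open scoped ENNReal Matrix Topology

noncomputable section

namespace Whittle

/-! ### Stationary Gaussian time series and spectral densities -/

/-- `{Z_t : t = 0, 1, …}` is a real, mean zero, stationary Gaussian time series under `P` with
autocovariance function `γ : ℤ → ℝ`, `Cov(Z_s, Z_t) = γ(t - s)`. -/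
structure IsStationaryGaussianSeries {Ω : Type*} [MeasurableSpace Ω] (P : Measure Ω)
    (Z : ℕ → Ω → ℝ) (γ : ℤ → ℝ) : Prop where
  gaussian : IsGaussianProcess Z P
  mean_zero : ∀ t, ∫ ω, Z t ω ∂P = 0
  autocov : ∀ s t : ℕ, covariance (Z s) (Z t) P = γ ((t : ℤ) - (s : ℤ))

/-- The spectral density `f(x) = (1 / 2π) ∑_{k ∈ ℤ} γ(k) exp(-i k x)`. The sum is real because
autocovariance functions are even; the real part only changes the codomain. -/
def spectralDensity (γ : ℤ → ℝ) (x : ℝ) : ℝ :=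
  (1 / (2 * (Real.pi : ℂ)) *
    ∑' k : ℤ, (γ k : ℂ) * Complex.exp (-Complex.I * (k : ℂ) * (x : ℂ))).re

/-- The regularity assumption on an autocovariance function: `∑ |h|^α |γ(h)| < ∞` for some
`α > 1`, and the spectral density is bounded below by some `β > 0` on `[-π, π]`. -/
def SpectralAssumption (γ : ℤ → ℝ) : Prop :=
  (∃ α : ℝ, 1 < α ∧ Summable fun h : ℤ => |(h : ℝ)| ^ α * |γ h|) ∧
  (∃ β : ℝ, 0 < β ∧ ∀ x ∈ Set.Icc (-Real.pi) Real.pi, β ≤ spectralDensity γ x)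

/-- The distribution of `(Z_1, …, Z_n)`; coordinate `t : Fin n` carries `Z_{t+1}`. -/
def seriesLaw {Ω : Type*} [MeasurableSpace Ω] (P : Measure Ω) (Z : ℕ → Ω → ℝ) (n : ℕ) :
    Measure (Fin n → ℝ) :=
  P.map fun ω (t : Fin n) => Z ((t : ℕ) + 1) ω

/-- The Lebesgue density of `(Z_1, …, Z_n)`. -/
def seriesDensity {Ω : Type*} [MeasurableSpace Ω] (P : Measure Ω) (Z : ℕ → Ω → ℝ) (n : ℕ) :
    (Fin n → ℝ) → ℝ≥0∞ :=
  (seriesLaw P Z n).rnDeriv volume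

/-! ### Fourier frequencies, periodogram and the real Fourier matrix -/

/-- The Fourier frequency `λ_j = 2πj/n`. -/
def fourierFreq (n j : ℕ) : ℝ := 2 * Real.pi * (j : ℝ) / (n : ℝ)

/-- The periodogram `I_n(x) = (1 / 2πn) |∑_{t=1}^n z_t exp(-i t x)|²`. -/
def periodogram (n : ℕ) (z : Fin n → ℝ) (x : ℝ) : ℝ :=
  1 / (2 * Real.pi * (n : ℝ)) *
    ‖∑ t : Fin n, (z t : ℂ) * Complex.exp (-Complex.I * ((t : ℕ) + 1 : ℂ) * (x : ℂ))‖ ^ 2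

/-- The vector `e_j = n^{-1/2} (e_j, e_j², …, e_j^n)` with `e_j = exp(-2πij/n)`. -/
def fourierVec (n j : ℕ) (t : Fin n) : ℂ :=
  (((n : ℝ) ^ (-(1 / 2) : ℝ) : ℝ) : ℂ) *
    Complex.exp (-2 * (Real.pi : ℂ) * Complex.I * (j : ℂ) / (n : ℂ)) ^ ((t : ℕ) + 1)

/-- The orthonormal `n × n` matrix `F_n` with rows `e_0, c_1, s_1, …, c_N, s_N` and, for even `n`,
the last row `e_{n/2}`; here `N = ⌊(n-1)/2⌋`, `c_j = √2 Re e_j` and `s_j = √2 Im e_j`. Row `i`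
belongs to the Fourier frequency with index `(i + 1) / 2`; the vectors `e_0` and `e_{n/2}` are
real. -/
def fourierMatrix (n : ℕ) : Matrix (Fin n) (Fin n) ℝ :=
  Matrix.of fun i t =>
    if (i : ℕ) = 0 ∨ (Even n ∧ (i : ℕ) + 1 = n) then (fourierVec n (((i : ℕ) + 1) / 2) t).re
    else if Odd (i : ℕ) then √2 * (fourierVec n (((i : ℕ) + 1) / 2) t).re
    else √2 * (fourierVec n (((i : ℕ) + 1) / 2) t).im

/-- The entries `c(λ_0), c(λ_1), c(λ_1), …, c(λ_N), c(λ_N)` and, for even `n`, `c(λ_{n/2})`. -/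
def freqDiag (c : ℝ → ℝ) (n : ℕ) (i : Fin n) : ℝ := c (fourierFreq n (((i : ℕ) + 1) / 2))

/-- The correction matrix `C_n(c)`. -/
def correctionMatrix (c : ℝ → ℝ) (n : ℕ) : Matrix (Fin n) (Fin n) ℝ :=
  Matrix.diagonal (freqDiag c n)

/-- The matrix `C_n(c)^{-1/2}`, for positive `c`. -/
def correctionInvSqrt (c : ℝ → ℝ) (n : ℕ) : Matrix (Fin n) (Fin n) ℝ :=
  Matrix.diagonal fun i => freqDiag c n i ^ (-(1 / 2) : ℝ)

/-! ### The Whittle and the corrected likelihood -/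

/-- The probability distribution on `ℝⁿ` whose Lebesgue density is proportional to `g`. -/
def normalizedLaw {n : ℕ} (g : (Fin n → ℝ) → ℝ≥0∞) : Measure (Fin n → ℝ) :=
  (∫⁻ z, g z)⁻¹ • (volume : Measure (Fin n → ℝ)).withDensity g

/-- The Whittle likelihood with spectral density `f`:
`p^W(z | f) ∝ exp{-(1/2) ∑_{j=0}^{n-1} (log f(λ_j) + I_n(λ_j) / f(λ_j))}`. -/
def whittleLaw (f : ℝ → ℝ) (n : ℕ) : Measure (Fin n → ℝ) :=
  normalizedLaw fun z => ENNReal.ofReal (Real.exp (-(1 / 2) * ∑ j ∈ Finset.range n,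
    (Real.log (f (fourierFreq n j)) +
      periodogram n z (fourierFreq n j) / f (fourierFreq n j))))

/-- The nonparametrically corrected likelihood with spectral density `f`, for a working model with
spectral density `fparam` and density `pparam` of the first `n` observations:
`p^C(z | f) ∝ det(C_n)^{-1/2} pparam(F_nᵀ C_n^{-1/2} F_n z)` with `C_n = C_n(f / fparam)`. -/
def correctedLaw (f fparam : ℝ → ℝ) (n : ℕ) (pparam : (Fin n → ℝ) → ℝ≥0∞) :
    Measure (Fin n → ℝ) :=
  normalizedLaw fun z =>
    ENNReal.ofReal ((correctionMatrix (fun x => f x / fparam x) n).det ^ (-(1 / 2) : ℝ)) *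
      pparam (((fourierMatrix n)ᵀ * correctionInvSqrt (fun x => f x / fparam x) n *
        fourierMatrix n) *ᵥ z)

/-! ### Contiguity -/

/-- `Q` is contiguous with respect to `P`: `P_n(A_n) → 0` implies `Q_n(A_n) → 0` for every sequence
of measurable sets. -/
def Contiguous {X : ℕ → Type*} [∀ n, MeasurableSpace (X n)] (Q P : ∀ n, Measure (X n)) : Prop :=
  ∀ A : ∀ n, Set (X n), (∀ n, MeasurableSet (A n)) →
    Tendsto (fun n => P n (A n)) atTop (𝓝 0) → Tendsto (fun n => Q n (A n)) atTop (𝓝 0)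

/-- Mutual contiguity of two sequences of measures. -/
def MutuallyContiguous {X : ℕ → Type*} [∀ n, MeasurableSpace (X n)]
    (P Q : ∀ n, Measure (X n)) : Prop :=
  Contiguous Q P ∧ Contiguous P Q

end Whittle

end

namespace Whittle

/-! ### Contiguity -/

/-! The Whittle law is exactly the centred Gaussian law whose covariance is the circulant matrix `D
= Fᵀ diag(2πf(λ_j)) F`, while the series has the Toeplitz covariance `Γ`. Everything rests on `Γ -
D` having Frobenius norm bounded in `n`. The entry of `D` at lag `h` is the sum of `γ(k)` over `k ≡
h` mod `n`, and a given `k` is wrapped onto a wrong lag in at most `|k|` matrix positions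
(`card_aliased_le`), so `∑ |k||γ(k)| < ∞` gives the bound (`sum_sq_sub_aliasedCov_le`).

Whitening by `D` and then rotating by an eigenbasis turns the Whittle law into the standard Gaussian
and the law of the series into a product of `N(0, l_i)` with `∑ (l_i - 1)²` bounded and `l_i`
bounded away from 0 (`exists_simultaneous_diagonalization`). For such products the likelihood ratio
has a moment of order `1 + δ` bounded uniformly in the dimension: the terms linear in `l_i - 1`
cancel, leaving only squares. Hölder's inequality then gives `P(A) ≤ C Q(A)^θ`
(`exists_pi_gaussianReal_le_rpow`). The bounds on `l_i` pass to `1 / l_i`, so both directions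
follow.

For the corrected law, the invertible map `Fᵀ C^{-1/2} F` sends the Whittle law of `f₀` to that of
`f_param` and the corrected law to the parametric law. The comparison already proved for the
parametric series is pulled back along this map, and transitivity supplies the third pair. -/

lemma Contiguous.trans {X : ℕ → Type*} [∀ n, MeasurableSpace (X n)]
    {P Q R : ∀ n, Measure (X n)} (hPQ : Contiguous P Q) (hQR : Contiguous Q R) :
    Contiguous P R :=
  fun A hA h => hPQ A hA (hQR A hA h)

lemma MutuallyContiguous.trans {X : ℕ → Type*} [∀ n, MeasurableSpace (X n)]
    {P Q R : ∀ n, Measure (X n)} (hPQ : MutuallyContiguous P Q) (hQR : MutuallyContiguous Q R) :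
    MutuallyContiguous P R :=
  ⟨hQR.1.trans hPQ.1, hPQ.2.trans hQR.2⟩

/-- A bound `P_n(A) ≤ K Q_n(A)^θ` that is uniform in `n` implies contiguity. -/
lemma contiguous_of_le_rpow {X : ℕ → Type*} [∀ n, MeasurableSpace (X n)]
    {P Q : ∀ n, Measure (X n)} {K : ℝ≥0∞} (hK : K ≠ ∞) {θ : ℝ} (hθ : 0 < θ)
    (h : ∀ᶠ n in atTop, ∀ A : Set (X n), MeasurableSet A → P n A ≤ K * Q n A ^ θ) :
    Contiguous P Q := by
  intro A hA hQ
  have h1 : Tendsto (fun n => K * Q n (A n) ^ θ) atTop (𝓝 (K * 0 ^ θ)) :=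
    ENNReal.Tendsto.const_mul ((ENNReal.continuous_rpow_const.tendsto 0).comp hQ) (Or.inr hK)
  rw [ENNReal.zero_rpow_of_pos hθ, mul_zero] at h1
  exact tendsto_of_tendsto_of_tendsto_of_le_of_le' tendsto_const_nhds h1
    (Eventually.of_forall fun _ => zero_le) (h.mono fun n hn => hn _ (hA n))

/-- Contiguity may be transported along measurable maps that have a measurable left inverse. -/
lemma Contiguous.of_map {X : ℕ → Type*} [∀ n, MeasurableSpace (X n)]
    {P Q P' Q' : ∀ n, Measure (X n)} {e g : ∀ n, X n → X n}
    (hP : ∀ n, P' n = (P n).map (e n)) (hQ : ∀ n, Q' n = (Q n).map (e n))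
    (he : ∀ n, Measurable (e n)) (hg : ∀ n, Measurable (g n)) (hge : ∀ n x, g n (e n x) = x)
    (h : Contiguous P' Q') : Contiguous P Q := by
  intro A hA hQA
  have key : ∀ (R R' : ∀ n, Measure (X n)), (∀ n, R' n = (R n).map (e n)) →
      ∀ n, R' n (g n ⁻¹' A n) = R n (A n) := by
    intro R R' hR n
    rw [hR n, Measure.map_apply (he n) (hg n (hA n)), ← Set.preimage_comp]
    congr 1
    ext x
    simp [hge]
  have := h (fun n => g n ⁻¹' A n) (fun n => hg n (hA n))
  simp only [key P P' hP, key Q Q' hQ] at this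
  exact this hQA

/-! ### Normalized laws -/

lemma map_withDensity_comp {α β : Type*} [MeasurableSpace α] [MeasurableSpace β] (μ : Measure α)
    {e : α → β} (he : Measurable e) {h : β → ℝ≥0∞} (hh : Measurable h) :
    (μ.withDensity fun x => h (e x)).map e = (μ.map e).withDensity h := by
  ext s hs
  rw [Measure.map_apply he hs, withDensity_apply _ (he hs), withDensity_apply _ hs,
    setLIntegral_map hs hh he]

lemma measurable_mulVec_const {n : ℕ} (A : Matrix (Fin n) (Fin n) ℝ) :
    Measurable fun z : Fin n → ℝ => A *ᵥ z :=
  (Continuous.matrix_mulVec continuous_const continuous_id).measurable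

/-- A normalized law with density `c · h(Az)` is transported by `A` to the one with density `h`. -/
lemma map_normalizedLaw_mulVec {n : ℕ} {A B : Matrix (Fin n) (Fin n) ℝ} (hAB : A * B = 1)
    {c : ℝ≥0∞} (hc : c ≠ 0) (hc' : c ≠ ∞) {h : (Fin n → ℝ) → ℝ≥0∞} (hh : Measurable h) :
    (normalizedLaw fun z => c * h (A *ᵥ z)).map (fun z => A *ᵥ z) = normalizedLaw h := by
  have hdet : A.det ≠ 0 := by
    intro h0
    have := congrArg Matrix.det hAB
    simp [h0] at this
  have hm := measurable_mulVec_const A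
  have hvol : (volume : Measure (Fin n → ℝ)).map (fun z => A *ᵥ z)
      = ENNReal.ofReal |A.det⁻¹| • volume :=
    Real.map_matrix_volume_pi_eq_smul_volume_pi hdet
  set k := ENNReal.ofReal |A.det⁻¹| with hk
  have hk0 : k ≠ 0 := by simp [hk, hdet]
  have hk1 : k ≠ ∞ := ENNReal.ofReal_ne_top
  have hint : ∫⁻ z : Fin n → ℝ, c * h (A *ᵥ z) = c * k * ∫⁻ z, h z := by
    rw [lintegral_const_mul _ (show Measurable fun z => h (A *ᵥ z) from hh.comp hm),
      ← lintegral_map hh hm, hvol, lintegral_smul_measure,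
      smul_eq_mul, mul_assoc]
  unfold normalizedLaw
  have hwd : (volume : Measure (Fin n → ℝ)).withDensity (fun z => c * h (A *ᵥ z))
      = c • (volume : Measure (Fin n → ℝ)).withDensity (fun z => h (A *ᵥ z)) :=
    withDensity_smul _ (hh.comp hm)
  rw [hint, hwd, Measure.map_smul, Measure.map_smul, map_withDensity_comp _ hm hh, hvol,
    withDensity_smul_measure, smul_smul, smul_smul, mul_assoc]
  congr 1
  rw [ENNReal.mul_inv (Or.inl (mul_ne_zero hc hk0)) (Or.inl (ENNReal.mul_ne_top hc' hk1)),
    mul_comm, ← mul_assoc, ENNReal.mul_inv_cancel (mul_ne_zero hc hk0)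
      (ENNReal.mul_ne_top hc' hk1), one_mul]

lemma normalizedLaw_const_mul {n : ℕ} {c : ℝ≥0∞} (hc : c ≠ 0) (hc' : c ≠ ∞)
    {h : (Fin n → ℝ) → ℝ≥0∞} (hh : Measurable h) :
    (normalizedLaw fun z => c * h z) = normalizedLaw h := by
  simpa using map_normalizedLaw_mulVec (A := 1) (B := 1) (by simp) hc hc' hh

lemma normalizedLaw_of_withDensity_eq {n : ℕ} {h : (Fin n → ℝ) → ℝ≥0∞}
    {μ : Measure (Fin n → ℝ)} [IsProbabilityMeasure μ]
    (hμ : (volume : Measure (Fin n → ℝ)).withDensity h = μ) : normalizedLaw h = μ := by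
  have : ∫⁻ z, h z = 1 := by
    have h1 : μ Set.univ = 1 := measure_univ
    rwa [← hμ, withDensity_apply _ MeasurableSet.univ, Measure.restrict_univ] at h1
  rw [normalizedLaw, this, hμ, inv_one, one_smul]

/-! ### Products of densities -/

lemma lintegral_prod_pi {ι : Type*} [Fintype ι] {E : ι → Type*} [∀ i, MeasurableSpace (E i)]
    (μ : ∀ i, Measure (E i)) [∀ i, IsProbabilityMeasure (μ i)] {r : ∀ i, E i → ℝ≥0∞}
    (hr : ∀ i, Measurable (r i)) :
    ∫⁻ x, ∏ i, r i (x i) ∂(Measure.pi μ) = ∏ i, ∫⁻ x, r i x ∂(μ i) := by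
  classical
  rw [lintegral_prod_eq_prod_lintegral_of_indepFun Finset.univ (fun i (x : ∀ i, E i) => r i (x i))
    (iIndepFun_pi fun i => (hr i).aemeasurable) (fun i => (hr i).comp (measurable_pi_apply i))]
  refine Finset.prod_congr rfl fun i _ => ?_
  rw [← lintegral_map (hr i) (measurable_pi_apply i), Measure.pi_map_eval]
  simp

lemma pi_withDensity {ι : Type*} [Fintype ι] {E : ι → Type*} [∀ i, MeasurableSpace (E i)]
    (μ : ∀ i, Measure (E i)) [∀ i, IsProbabilityMeasure (μ i)] {r : ∀ i, E i → ℝ≥0∞}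
    (hr : ∀ i, Measurable (r i)) [∀ i, SigmaFinite ((μ i).withDensity (r i))] :
    Measure.pi (fun i => (μ i).withDensity (r i))
      = (Measure.pi μ).withDensity fun x => ∏ i, r i (x i) := by
  refine Measure.pi_eq fun s hs => ?_
  rw [withDensity_apply _ (MeasurableSet.univ_pi hs), ← lintegral_indicator
    (MeasurableSet.univ_pi hs)]
  have : (Set.univ.pi s).indicator (fun x : ∀ i, E i => ∏ i, r i (x i))
      = fun x => ∏ i, (s i).indicator (r i) (x i) := by
    ext x
    by_cases hx : x ∈ Set.univ.pi s
    · rw [Set.indicator_of_mem hx]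
      exact Finset.prod_congr rfl fun i _ => by
        rw [Set.indicator_of_mem (hx i (Set.mem_univ i))]
    · rw [Set.indicator_of_notMem hx]
      simp only [Set.mem_pi, Set.mem_univ, true_implies, not_forall] at hx
      obtain ⟨i, hi⟩ := hx
      exact (Finset.prod_eq_zero (Finset.mem_univ i) (Set.indicator_of_notMem hi _)).symm
  rw [this, lintegral_prod_pi μ fun i => (hr i).indicator (hs i)]
  exact Finset.prod_congr rfl fun i _ => by
    rw [lintegral_indicator (hs i), withDensity_apply _ (hs i)]

/-! ### Products of centred Gaussian laws -/

lemma gaussianPDFReal_zero_eq_exp {v : ℝ} (hv : 0 < v) (x : ℝ) :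
    gaussianPDFReal 0 v.toNNReal x
      = Real.exp (-(1 / 2) * Real.log (2 * Real.pi * v) - x ^ 2 / (2 * v)) := by
  have h2 : 0 < 2 * Real.pi * v := by positivity
  rw [gaussianPDFReal_def, Real.coe_toNNReal _ hv.le]
  simp only [sub_zero]
  rw [sub_eq_add_neg, Real.exp_add, neg_div]
  congr 1
  rw [Real.sqrt_eq_rpow, ← Real.rpow_neg h2.le, Real.rpow_def_of_pos h2]
  ring_nf

/-- The likelihood ratio of two centred Gaussian laws. -/
noncomputable def gaussianRatio (u v : ℝ) (x : ℝ) : ℝ≥0∞ :=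
  ENNReal.ofReal (Real.exp (-(1 / 2) * Real.log (u / v) - x ^ 2 / 2 * (1 / u - 1 / v)))

lemma measurable_gaussianRatio (u v : ℝ) : Measurable (gaussianRatio u v) := by
  unfold gaussianRatio
  fun_prop

lemma gaussianReal_eq_withDensity_ratio {u v : ℝ} (hu : 0 < u) (hv : 0 < v) :
    gaussianReal 0 u.toNNReal = (gaussianReal 0 v.toNNReal).withDensity (gaussianRatio u v) := by
  have hu' : u.toNNReal ≠ 0 := by simpa using hu
  have hv' : v.toNNReal ≠ 0 := by simpa using hv
  rw [gaussianReal_of_var_ne_zero _ hu', gaussianReal_of_var_ne_zero _ hv',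
    ← withDensity_mul _ (measurable_gaussianPDF _ _) (measurable_gaussianRatio u v)]
  congr 1
  ext x
  rw [Pi.mul_apply, gaussianPDF, gaussianPDF, gaussianRatio,
    ← ENNReal.ofReal_mul (gaussianPDFReal_nonneg _ _ _), gaussianPDFReal_zero_eq_exp hu,
    gaussianPDFReal_zero_eq_exp hv, ← Real.exp_add]
  congr 2
  rw [Real.log_div hu.ne' hv.ne', Real.log_mul (by positivity) hu.ne',
    Real.log_mul (by positivity) hv.ne']
  field_simp
  ring

/-- The first-order term is kept exact so that the linear parts of two such bounds can cancel. -/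
lemma neg_log_le_of_le {c x : ℝ} (hc : 0 < c) (hx : c ≤ x) :
    -Real.log x ≤ (1 - x) + (1 - x) ^ 2 / c := by
  have hx0 : 0 < x := hc.trans_le hx
  have h1 : -Real.log x ≤ 1 / x - 1 := by
    rw [← Real.log_inv, one_div]
    exact Real.log_le_sub_one_of_pos (inv_pos.2 hx0)
  have h2 : 1 / x - 1 = (1 - x) + (1 - x) ^ 2 / x := by
    field_simp
    ring
  have h3 : (1 - x) ^ 2 / x ≤ (1 - x) ^ 2 / c := by gcongr
  linarith

/-- A moment of order `1 + δ` of the likelihood ratio of two centred Gaussian laws. -/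
lemma lintegral_gaussianRatio_rpow_le {u v a δ : ℝ} (hu : 0 < u) (hv : 0 < v) (ha : 0 < a)
    (hau : a ≤ u / v) (hδ : 0 < δ) (hδu : δ * (u / v - 1) ≤ 1 / 2) :
    ∫⁻ x, gaussianRatio u v x ^ (1 + δ) ∂(gaussianReal 0 v.toNNReal)
      ≤ ENNReal.ofReal (Real.exp ((δ / a + 2 * δ ^ 2) * (u / v - 1) ^ 2)) := by
  have hv' : v.toNNReal ≠ 0 := by simpa using hv
  set l := u / v with hl
  have hl0 : 0 < l := by positivity
  have hul : u = l * v := by rw [hl]; field_simp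
  have hden : 0 < 1 - δ * (l - 1) := by linarith
  -- The integrand is again an unnormalized centred Gaussian density: its precision `1/v + (1+δ)(1/u
  -- - 1/v)` equals `1/w`, and positivity of `1 - δ(l-1)` is what makes the moment finite.
  set w := u / (1 - δ * (l - 1)) with hw
  have hw0 : 0 < w := by positivity
  have hw' : w.toNNReal ≠ 0 := by simpa using hw0
  set C := (1 / 2) * (-δ * Real.log l - Real.log (1 - δ * (l - 1))) with hC
  have hpt : ∀ x, gaussianPDF 0 v.toNNReal x * gaussianRatio u v x ^ (1 + δ)
      = ENNReal.ofReal (Real.exp C) * ENNReal.ofReal (gaussianPDFReal 0 w.toNNReal x) := by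
    intro x
    rw [gaussianPDF, gaussianRatio, ENNReal.ofReal_rpow_of_pos (Real.exp_pos _),
      ← Real.exp_mul, ← ENNReal.ofReal_mul (gaussianPDFReal_nonneg _ _ _),
      ← ENNReal.ofReal_mul (Real.exp_pos _).le, gaussianPDFReal_zero_eq_exp hv,
      gaussianPDFReal_zero_eq_exp hw0, ← Real.exp_add, ← Real.exp_add]
    congr 2
    have hlw : Real.log (2 * Real.pi * w)
        = Real.log (2 * Real.pi * v) + Real.log l - Real.log (1 - δ * (l - 1)) := by
      rw [hw, hul, ← Real.log_mul (by positivity) hl0.ne', ← Real.log_div (by positivity) hden.ne']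
      congr 1
      field_simp
    have hq : x ^ 2 / (2 * w)
        = x ^ 2 / (2 * v) + x ^ 2 / 2 * (1 / u - 1 / v) * (1 + δ) := by
      rw [hw, hul]
      field_simp
      ring
    rw [hlw, hq, hC, ← hl]
    ring
  have hmain : ∫⁻ x, gaussianRatio u v x ^ (1 + δ) ∂(gaussianReal 0 v.toNNReal)
      = ENNReal.ofReal (Real.exp C) := by
    rw [gaussianReal_of_var_ne_zero _ hv', lintegral_withDensity_eq_lintegral_mul _
      (measurable_gaussianPDF _ _) ((measurable_gaussianRatio u v).pow_const _)]
    simp only [Pi.mul_apply, hpt]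
    rw [lintegral_const_mul _ (measurable_gaussianPDFReal _ _).ennreal_ofReal,
      lintegral_gaussianPDFReal_eq_one _ hw', mul_one]
  rw [hmain]
  apply ENNReal.ofReal_le_ofReal
  apply Real.exp_le_exp.2
  have h1 := neg_log_le_of_le ha hau
  have h2 := neg_log_le_of_le (c := 1 / 2) (x := 1 - δ * (l - 1)) (by norm_num) (by linarith)
  have h3 : δ * -Real.log l ≤ δ * ((1 - l) + (1 - l) ^ 2 / a) :=
    mul_le_mul_of_nonneg_left h1 hδ.le
  have h4 : 0 ≤ (δ / a + 2 * δ ^ 2) * (l - 1) ^ 2 := by positivity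
  -- The linear terms `δ(1-l)` and `δ(l-1)` cancel; only squares remain, which is what makes the
  -- bound summable over coordinates.
  have h5 : δ * ((1 - l) + (1 - l) ^ 2 / a) + (1 - (1 - δ * (l - 1)) + (1 - (1 - δ * (l - 1))) ^ 2
      / (1 / 2)) = (δ / a + 2 * δ ^ 2) * (l - 1) ^ 2 := by
    field_simp
    ring
  rw [hC]
  linarith

/-- Two products of centred Gaussian laws whose variance ratios `u_i / v_i` satisfy
`∑ (u_i / v_i - 1)² ≤ K` and `a ≤ u_i / v_i`, with constants independent of the dimension. -/
lemma exists_pi_gaussianReal_le_rpow {a K : ℝ} (ha : 0 < a) :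
    ∃ C : ℝ≥0∞, C ≠ ∞ ∧ ∃ θ : ℝ, 0 < θ ∧ ∀ (n : ℕ) (u v : Fin n → ℝ), (∀ i, 0 < u i) →
      (∀ i, 0 < v i) → (∀ i, a ≤ u i / v i) → ∑ i, (u i / v i - 1) ^ 2 ≤ K →
      ∀ A : Set (Fin n → ℝ), MeasurableSet A →
        Measure.pi (fun i => gaussianReal 0 (u i).toNNReal) A
          ≤ C * Measure.pi (fun i => gaussianReal 0 (v i).toNNReal) A ^ θ := by
  by_cases hK : K < 0
  · refine ⟨0, by simp, 1, one_pos, fun n u v _ _ _ h => ?_⟩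
    exact absurd (h.trans_lt hK) (not_lt.2 (Finset.sum_nonneg fun i _ => sq_nonneg _))
  push Not at hK
  -- Each ratio satisfies `u/v - 1 ≤ K + 1` because its square is at most `K`; this `δ` therefore
  -- gives `δ(u/v - 1) ≤ 1/2` in every coordinate and every dimension.
  set δ : ℝ := 1 / (2 * (K + 1)) with hδdef
  have hδ : 0 < δ := by positivity
  have hconj : (1 + δ).HolderConjugate ((1 + δ) / δ) := by
    rw [Real.holderConjugate_iff]
    refine ⟨by linarith, ?_⟩
    field_simp
  refine ⟨ENNReal.ofReal (Real.exp ((δ / a + 2 * δ ^ 2) * K)) ^ (1 / (1 + δ)),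
    (ENNReal.rpow_lt_top_of_nonneg (by positivity) ENNReal.ofReal_ne_top).ne,
    1 / ((1 + δ) / δ), by positivity, fun n u v hu hv hau hsum A hA => ?_⟩
  have hle : ∀ i, δ * (u i / v i - 1) ≤ 1 / 2 := by
    intro i
    have h1 : (u i / v i - 1) ^ 2 ≤ K :=
      (Finset.single_le_sum (f := fun i => (u i / v i - 1) ^ 2) (fun i _ => sq_nonneg _)
        (Finset.mem_univ i)).trans hsum
    have h2 : u i / v i - 1 ≤ K + 1 := by nlinarith
    rw [hδdef]
    rw [div_mul_eq_mul_div, div_le_div_iff₀ (by positivity) (by norm_num)]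
    linarith
  have hm : ∀ i, Measurable (gaussianRatio (u i) (v i)) := fun i => measurable_gaussianRatio _ _
  have hsf : ∀ i, SigmaFinite ((gaussianReal 0 (v i).toNNReal).withDensity
      (gaussianRatio (u i) (v i))) := fun i => by
    rw [← gaussianReal_eq_withDensity_ratio (hu i) (hv i)]
    infer_instance
  set Q := Measure.pi fun i => gaussianReal 0 (v i).toNNReal with hQ
  have hP : Measure.pi (fun i => gaussianReal 0 (u i).toNNReal)
      = Q.withDensity fun x => ∏ i, gaussianRatio (u i) (v i) (x i) := by
    rw [hQ, ← pi_withDensity _ hm]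
    congr 1
    ext1 i
    exact gaussianReal_eq_withDensity_ratio (hu i) (hv i)
  have hmr : Measurable fun x : Fin n → ℝ => ∏ i, gaussianRatio (u i) (v i) (x i) :=
    Finset.measurable_prod _ fun i _ => (hm i).comp (measurable_pi_apply i)
  rw [hP, withDensity_apply _ hA, ← lintegral_indicator hA]
  have hind : A.indicator (fun x : Fin n → ℝ => ∏ i, gaussianRatio (u i) (v i) (x i))
      = (fun x => ∏ i, gaussianRatio (u i) (v i) (x i)) * A.indicator 1 := by
    ext x
    by_cases hx : x ∈ A <;> simp [hx]
  rw [hind]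
  refine (ENNReal.lintegral_mul_le_Lp_mul_Lq Q hconj hmr.aemeasurable
    (measurable_one.indicator hA).aemeasurable).trans ?_
  have hI : ∫⁻ x, (A.indicator (1 : (Fin n → ℝ) → ℝ≥0∞) x) ^ ((1 + δ) / δ) ∂Q = Q A := by
    rw [← lintegral_indicator_one hA]
    refine lintegral_congr fun x => ?_
    by_cases hx : x ∈ A
    · simp [hx]
    · simp [hx, ENNReal.zero_rpow_of_pos (show 0 < (1 + δ) / δ by positivity)]
  rw [hI]
  gcongr
  have hprod : ∀ x : Fin n → ℝ, (∏ i, gaussianRatio (u i) (v i) (x i)) ^ (1 + δ)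
      = ∏ i, gaussianRatio (u i) (v i) (x i) ^ (1 + δ) := fun x =>
    (ENNReal.prod_rpow_of_nonneg (by positivity)).symm
  simp only [hprod]
  rw [hQ, lintegral_prod_pi _ fun i => (hm i).pow_const _]
  calc ∏ i, ∫⁻ x, gaussianRatio (u i) (v i) x ^ (1 + δ) ∂(gaussianReal 0 (v i).toNNReal)
      ≤ ∏ i, ENNReal.ofReal (Real.exp ((δ / a + 2 * δ ^ 2) * (u i / v i - 1) ^ 2)) :=
        Finset.prod_le_prod' fun i _ =>
          lintegral_gaussianRatio_rpow_le (hu i) (hv i) ha (hau i) hδ (hle i)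
    _ = ENNReal.ofReal (Real.exp ((δ / a + 2 * δ ^ 2) * ∑ i, (u i / v i - 1) ^ 2)) := by
        rw [← ENNReal.ofReal_prod_of_nonneg fun i _ => (Real.exp_pos _).le, ← Real.exp_sum,
          Finset.mul_sum]
    _ ≤ _ := by
        apply ENNReal.ofReal_le_ofReal
        apply Real.exp_le_exp.2
        gcongr

/-! ### The standard Gaussian law as a normalized law. -/

/-- The density kernel of the standard Gaussian law on `ℝⁿ`. -/
noncomputable def gaussianKernel {n : ℕ} (x : Fin n → ℝ) : ℝ≥0∞ :=
  ENNReal.ofReal (Real.exp (-(1 / 2) * ∑ i, x i ^ 2))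

lemma measurable_gaussianKernel {n : ℕ} : Measurable (gaussianKernel (n := n)) := by
  unfold gaussianKernel
  fun_prop

/-- `pi_withDensity` needs probability measures as base, so Lebesgue measure is itself written as
the Gaussian law with density `1 / gaussianPDF`, and the two densities then multiply to 1. -/
lemma volume_withDensity_prod_gaussianPDF (n : ℕ) :
    (volume : Measure (Fin n → ℝ)).withDensity (fun x => ∏ i, gaussianPDF 0 1 (x i))
      = Measure.pi fun _ => gaussianReal 0 1 := by
  have hpdf : Measurable (gaussianPDF 0 1) := measurable_gaussianPDF _ _
  have hvol : (gaussianReal 0 1).withDensity (gaussianPDF 0 1)⁻¹ = volume := by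
    rw [gaussianReal_of_var_ne_zero _ one_ne_zero]
    exact withDensity_inv_same hpdf (ae_of_all _ fun x => (gaussianPDF_pos _ one_ne_zero x).ne')
      (ae_of_all _ fun x => gaussianPDF_ne_top)
  have hs : ∀ _ : Fin n, SigmaFinite ((gaussianReal 0 1).withDensity (gaussianPDF 0 1)⁻¹) :=
    fun _ => by rw [hvol]; infer_instance
  have h1 := @pi_withDensity _ _ _ _ (fun _ : Fin n => gaussianReal 0 1) _
    (fun _ => (gaussianPDF 0 1)⁻¹) (fun _ => hpdf.inv) hs
  simp only [hvol] at h1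
  rw [← volume_pi] at h1
  rw [h1, ← withDensity_mul]
  · have : ((fun x : Fin n → ℝ => ∏ i, (gaussianPDF 0 1)⁻¹ (x i))
        * fun x => ∏ i, gaussianPDF 0 1 (x i)) = 1 := by
      ext x
      rw [Pi.mul_apply, ← Finset.prod_mul_distrib, Pi.one_apply]
      exact Finset.prod_eq_one fun i _ =>
        ENNReal.inv_mul_cancel (gaussianPDF_pos _ one_ne_zero _).ne' gaussianPDF_ne_top
    rw [this, withDensity_one]
  · exact Finset.measurable_prod _ fun i _ => hpdf.inv.comp (measurable_pi_apply i)
  · exact Finset.measurable_prod _ fun i _ => hpdf.comp (measurable_pi_apply i)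

lemma normalizedLaw_gaussianKernel (n : ℕ) :
    normalizedLaw (gaussianKernel (n := n)) = Measure.pi fun _ => gaussianReal 0 1 := by
  rw [← normalizedLaw_of_withDensity_eq (volume_withDensity_prod_gaussianPDF n)]
  set c : ℝ := Real.exp (∑ _i : Fin n, -(1 / 2) * Real.log (2 * Real.pi * 1)) with hc
  rw [← normalizedLaw_const_mul (c := ENNReal.ofReal c)
    (by simpa using Real.exp_pos _) ENNReal.ofReal_ne_top measurable_gaussianKernel]
  congr 1
  ext x
  have h1 : ∀ y, gaussianPDF 0 1 y = ENNReal.ofReal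
      (Real.exp (-(1 / 2) * Real.log (2 * Real.pi * 1) - y ^ 2 / (2 * 1))) := fun y => by
    rw [← gaussianPDFReal_zero_eq_exp one_pos, gaussianPDF, Real.toNNReal_one]
  simp only [h1]
  rw [← ENNReal.ofReal_prod_of_nonneg fun i _ => (Real.exp_pos _).le, ← Real.exp_sum,
    gaussianKernel, ← ENNReal.ofReal_mul (Real.exp_pos _).le, ← Real.exp_add,
    Finset.sum_sub_distrib, Finset.mul_sum, sub_eq_add_neg, ← Finset.sum_neg_distrib]
  congr 4
  ext i
  ring

/-! ### The discrete Fourier basis -/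

lemma fourierFreq_sub {n j : ℕ} (hn : 0 < n) (hj : j ≤ n) :
    fourierFreq n (n - j) = 2 * Real.pi - fourierFreq n j := by
  have : (n : ℝ) ≠ 0 := by positivity
  unfold fourierFreq
  rw [Nat.cast_sub hj]
  field_simp

/-- Real part of the geometric sum of an `n`-th root of unity. -/
lemma inv_mul_sum_cos_fourierFreq {n : ℕ} (hn : 0 < n) (h : ℤ) :
    (n : ℝ)⁻¹ * ∑ j ∈ Finset.range n, Real.cos (h * fourierFreq n j)
      = if (n : ℤ) ∣ h then 1 else 0 := by
  have hn0 : (n : ℝ) ≠ 0 := by positivity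
  have hn1 : (n : ℂ) ≠ 0 := by exact_mod_cast hn.ne'
  set ζ : ℂ := Complex.exp (2 * Real.pi * Complex.I * (h / n)) with hζ
  have hpow : ∀ j : ℕ, (ζ ^ j).re = Real.cos (h * fourierFreq n j) := by
    intro j
    rw [hζ, ← Complex.exp_nat_mul]
    have : (j : ℂ) * (2 * Real.pi * Complex.I * (h / n))
        = ((h * fourierFreq n j : ℝ) : ℂ) * Complex.I := by
      unfold fourierFreq
      push_cast
      ring
    rw [this, Complex.exp_ofReal_mul_I_re]
  have hsum : ∑ j ∈ Finset.range n, Real.cos (h * fourierFreq n j)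
      = (∑ j ∈ Finset.range n, ζ ^ j).re := by
    rw [Complex.re_sum]
    exact Finset.sum_congr rfl fun j _ => (hpow j).symm
  have hone : ζ = 1 ↔ (n : ℤ) ∣ h := by
    rw [hζ, Complex.exp_eq_one_iff]
    have hpi : (2 * Real.pi * Complex.I : ℂ) ≠ 0 := Complex.two_pi_I_ne_zero
    constructor
    · rintro ⟨m, hm⟩
      refine ⟨m, ?_⟩
      have h2 : (h : ℂ) / n = m := mul_left_cancel₀ hpi (by rw [hm]; ring)
      rw [div_eq_iff hn1] at h2
      have : (h : ℂ) = ((n * m : ℤ) : ℂ) := by rw [h2]; push_cast; ring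
      exact_mod_cast this
    · rintro ⟨m, hm⟩
      refine ⟨m, ?_⟩
      rw [hm]
      push_cast
      field_simp
  rw [hsum]
  split_ifs with hd
  · rw [hone.2 hd]
    simp [hn0]
  · have hζn : ζ ^ n = 1 := by
      rw [hζ, ← Complex.exp_nat_mul, Complex.exp_eq_one_iff]
      exact ⟨h, by field_simp⟩
    have hne : ζ ≠ 1 := fun h1 => hd (hone.1 h1)
    rw [geom_sum_eq hne, hζn]
    simp

/-- The entries of `fourierMatrix`, with a natural number as row index. -/
noncomputable def fourierEntry (n i : ℕ) (t : Fin n) : ℝ :=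
  if i = 0 ∨ (Even n ∧ i + 1 = n) then (fourierVec n ((i + 1) / 2) t).re
  else if Odd i then √2 * (fourierVec n ((i + 1) / 2) t).re
  else √2 * (fourierVec n ((i + 1) / 2) t).im

lemma fourierVec_eq {n : ℕ} (j : ℕ) (t : Fin n) :
    fourierVec n j t = (((√n)⁻¹ : ℝ) : ℂ) *
      Complex.exp (((-((t : ℕ) + 1 : ℝ) * fourierFreq n j : ℝ) : ℂ) * Complex.I) := by
  unfold fourierVec
  rw [← Complex.exp_nat_mul, Real.rpow_neg (Nat.cast_nonneg n), ← Real.sqrt_eq_rpow]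
  congr 2
  unfold fourierFreq
  push_cast
  ring

lemma fourierVec_re {n : ℕ} (j : ℕ) (t : Fin n) :
    (fourierVec n j t).re = (√n)⁻¹ * Real.cos (((t : ℕ) + 1) * fourierFreq n j) := by
  rw [fourierVec_eq, Complex.re_ofReal_mul, Complex.exp_ofReal_mul_I_re, neg_mul, Real.cos_neg]

lemma fourierVec_im {n : ℕ} (j : ℕ) (t : Fin n) :
    (fourierVec n j t).im = -((√n)⁻¹ * Real.sin (((t : ℕ) + 1) * fourierFreq n j)) := by
  rw [fourierVec_eq, Complex.im_ofReal_mul, Complex.exp_ofReal_mul_I_im, neg_mul, Real.sin_neg,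
    mul_neg]

lemma inv_sqrt_mul_inv_sqrt (n : ℕ) : (√n : ℝ)⁻¹ * (√n)⁻¹ = (n : ℝ)⁻¹ := by
  rw [← mul_inv, Real.mul_self_sqrt (Nat.cast_nonneg n)]

lemma fourierEntry_zero_mul {n : ℕ} (s t : Fin n) :
    fourierEntry n 0 s * fourierEntry n 0 t = (n : ℝ)⁻¹ := by
  simp [fourierEntry, fourierVec_re, fourierFreq, inv_sqrt_mul_inv_sqrt]

/-- The cosine and sine rows of one frequency combine by the addition formula. The factor 2 from `√2
· √2` stands for the mirror frequency `λ_{n-j-1}`, and the time shift `t + 1` drops out of the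
difference. -/
lemma fourierEntry_pair {n j : ℕ} (s t : Fin n)
    (hlast : ¬ (Even n ∧ 2 * j + 2 = n)) (hlast' : ¬ (Even n ∧ 2 * j + 3 = n)) :
    fourierEntry n (2 * j + 1) s * fourierEntry n (2 * j + 1) t
        + fourierEntry n (2 * j + 2) s * fourierEntry n (2 * j + 2) t
      = (n : ℝ)⁻¹ * (2 * Real.cos (((s : ℤ) - (t : ℤ) : ℤ) * fourierFreq n (j + 1))) := by
  have h1 : (2 * j + 1 + 1) / 2 = j + 1 := by omega
  have h2 : (2 * j + 2 + 1) / 2 = j + 1 := by omega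
  have o1 : Odd (2 * j + 1) := ⟨j, rfl⟩
  have o2 : ¬ Odd (2 * j + 2) := by simp [parity_simps]
  have e1 : ∀ u : Fin n, fourierEntry n (2 * j + 1) u
      = √2 * ((√n)⁻¹ * Real.cos (((u : ℕ) + 1) * fourierFreq n (j + 1))) := by
    intro u
    rw [fourierEntry, if_neg (not_or.2 ⟨by omega, hlast⟩), if_pos o1, h1, fourierVec_re]
  have e2 : ∀ u : Fin n, fourierEntry n (2 * j + 2) u
      = √2 * -((√n)⁻¹ * Real.sin (((u : ℕ) + 1) * fourierFreq n (j + 1))) := by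
    intro u
    rw [fourierEntry, if_neg (not_or.2 ⟨by omega, hlast'⟩), if_neg o2, h2, fourierVec_im]
  have hc : Real.cos (((s : ℤ) - (t : ℤ) : ℤ) * fourierFreq n (j + 1))
      = Real.cos ((((s : ℕ) : ℝ) + 1) * fourierFreq n (j + 1)
        - (((t : ℕ) : ℝ) + 1) * fourierFreq n (j + 1)) := by
    congr 1
    push_cast
    ring
  rw [e1, e1, e2, e2, hc, Real.cos_sub, ← inv_sqrt_mul_inv_sqrt]
  have h22 : √2 * √2 = (2 : ℝ) := Real.mul_self_sqrt (by norm_num)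
  linear_combination ((√n)⁻¹ * (√n)⁻¹ * (Real.cos ((((s : ℕ) : ℝ) + 1) * fourierFreq n (j + 1))
    * Real.cos ((((t : ℕ) : ℝ) + 1) * fourierFreq n (j + 1))
    + Real.sin ((((s : ℕ) : ℝ) + 1) * fourierFreq n (j + 1))
    * Real.sin ((((t : ℕ) : ℝ) + 1) * fourierFreq n (j + 1)))) * h22

/-- At frequency `π` all sines vanish, so the cosine row alone yields the cosine of the difference,
without the factor 2. -/
lemma fourierEntry_last {m : ℕ} (s t : Fin (2 * m + 2)) :
    fourierEntry (2 * m + 2) (2 * m + 1) s * fourierEntry (2 * m + 2) (2 * m + 1) t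
      = ((2 * m + 2 : ℕ) : ℝ)⁻¹
        * Real.cos (((s : ℤ) - (t : ℤ) : ℤ) * fourierFreq (2 * m + 2) (m + 1)) := by
  have h1 : (2 * m + 1 + 1) / 2 = m + 1 := by omega
  have hpi : fourierFreq (2 * m + 2) (m + 1) = Real.pi := by
    unfold fourierFreq
    push_cast
    field_simp
  have he : Even (2 * m + 2) := ⟨m + 1, by ring⟩
  have e1 : ∀ u, fourierEntry (2 * m + 2) (2 * m + 1) u
      = (√(2 * m + 2 : ℕ))⁻¹ * Real.cos (((u : ℕ) + 1) * Real.pi) := by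
    intro u
    rw [fourierEntry, if_pos (Or.inr ⟨he, rfl⟩), h1, fourierVec_re, hpi]
  have hs : Real.sin ((((s : ℕ) : ℝ) + 1) * Real.pi) = 0 := by
    exact_mod_cast Real.sin_nat_mul_pi (s + 1)
  have hc : Real.cos (((s : ℤ) - (t : ℤ) : ℤ) * Real.pi)
      = Real.cos ((((s : ℕ) : ℝ) + 1) * Real.pi - (((t : ℕ) : ℝ) + 1) * Real.pi) := by
    congr 1
    push_cast
    ring
  rw [e1, e1, hpi, hc, Real.cos_sub, hs, ← inv_sqrt_mul_inv_sqrt]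
  ring

/-! ### Folding sums over the Fourier frequencies along `j ↔ n - j`. -/

lemma sum_range_two_mul_add_one (b : ℕ → ℝ) (m : ℕ) :
    ∑ i ∈ Finset.range (2 * m + 1), b i
      = b 0 + ∑ j ∈ Finset.range m, (b (2 * j + 1) + b (2 * j + 2)) := by
  induction m with
  | zero => simp
  | succ m ih =>
    rw [show 2 * (m + 1) + 1 = 2 * m + 1 + 1 + 1 by ring, Finset.sum_range_succ,
      Finset.sum_range_succ, ih, Finset.sum_range_succ]
    ring

lemma sum_range_symm_odd {m : ℕ} {ψ : ℕ → ℝ}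
    (hψ : ∀ j, 0 < j → j < 2 * m + 1 → ψ (2 * m + 1 - j) = ψ j) :
    ∑ j ∈ Finset.range (2 * m + 1), ψ j = ψ 0 + ∑ j ∈ Finset.range m, 2 * ψ (j + 1) := by
  rw [Finset.sum_range_succ', two_mul, Finset.sum_range_add]
  have : ∑ x ∈ Finset.range m, ψ (m + x + 1) = ∑ x ∈ Finset.range m, ψ (x + 1) := by
    rw [← Finset.sum_range_reflect]
    refine Finset.sum_congr rfl fun x hx => ?_
    have hx := Finset.mem_range.1 hx
    rw [← hψ (x + 1) (by omega) (by omega)]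
    congr 1
    omega
  rw [this, ← Finset.mul_sum]
  ring

lemma sum_range_symm_even {m : ℕ} {ψ : ℕ → ℝ}
    (hψ : ∀ j, 0 < j → j < 2 * m + 2 → ψ (2 * m + 2 - j) = ψ j) :
    ∑ j ∈ Finset.range (2 * m + 2), ψ j
      = ψ 0 + ∑ j ∈ Finset.range m, 2 * ψ (j + 1) + ψ (m + 1) := by
  rw [Finset.sum_range_succ', show 2 * m + 1 = m + 1 + m by ring, Finset.sum_range_add,
    Finset.sum_range_succ]
  have : ∑ x ∈ Finset.range m, ψ (m + 1 + x + 1) = ∑ x ∈ Finset.range m, ψ (x + 1) := by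
    rw [← Finset.sum_range_reflect]
    refine Finset.sum_congr rfl fun x hx => ?_
    have hx := Finset.mem_range.1 hx
    rw [← hψ (x + 1) (by omega) (by omega)]
    congr 1
    omega
  rw [this, ← Finset.mul_sum]
  ring

/-- `F_nᵀ diag(g) F_n` is the circulant matrix with eigenvalues `g(λ_j)`. -/
lemma sum_freqDiag_mul_fourierMatrix {n : ℕ} (hn : 0 < n) {g : ℝ → ℝ}
    (hg : ∀ x, g (2 * Real.pi - x) = g x) (s t : Fin n) :
    ∑ i, freqDiag g n i * (fourierMatrix n i s * fourierMatrix n i t)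
      = (n : ℝ)⁻¹ * ∑ j ∈ Finset.range n,
          g (fourierFreq n j) * Real.cos (((s : ℤ) - (t : ℤ) : ℤ) * fourierFreq n j) := by
  set h : ℤ := (s : ℤ) - (t : ℤ) with hh
  set ψ : ℕ → ℝ := fun j => g (fourierFreq n j) * Real.cos (h * fourierFreq n j) with hψ
  set b : ℕ → ℝ := fun i => g (fourierFreq n ((i + 1) / 2))
    * (fourierEntry n i s * fourierEntry n i t) with hb
  have hsym : ∀ j, 0 < j → j < n → ψ (n - j) = ψ j := by
    intro j _ hj
    simp only [hψ]
    rw [fourierFreq_sub hn hj.le, hg, mul_sub, Real.cos_int_mul_two_pi_sub]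
  have hb0 : b 0 = (n : ℝ)⁻¹ * ψ 0 := by
    simp only [hb, hψ]
    rw [fourierEntry_zero_mul]
    simp [fourierFreq, mul_comm]
  have hbj : ∀ j, ¬ (Even n ∧ 2 * j + 2 = n) → ¬ (Even n ∧ 2 * j + 3 = n) →
      b (2 * j + 1) + b (2 * j + 2) = (n : ℝ)⁻¹ * (2 * ψ (j + 1)) := by
    intro j h1 h2
    have := fourierEntry_pair (n := n) (j := j) s t h1 h2
    simp only [hb, hψ]
    rw [show (2 * j + 1 + 1) / 2 = j + 1 by omega, show (2 * j + 2 + 1) / 2 = j + 1 by omega,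
      ← mul_add, this]
    ring
  have hL : ∑ i, freqDiag g n i * (fourierMatrix n i s * fourierMatrix n i t)
      = ∑ i ∈ Finset.range n, b i := by
    rw [← Fin.sum_univ_eq_sum_range]
    rfl
  rw [hL]
  change _ = (n : ℝ)⁻¹ * ∑ j ∈ Finset.range n, ψ j
  -- Frequency 0 is always unpaired; for even `n` so is `n/2`, the last row of the matrix.
  rcases Nat.even_or_odd' n with ⟨m, hm | hm⟩
  · obtain ⟨m, rfl⟩ : ∃ k, m = k + 1 := ⟨m - 1, by omega⟩
    have hm' : n = 2 * m + 2 := by omega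
    have hlast : b (2 * m + 1) = (n : ℝ)⁻¹ * ψ (m + 1) := by
      simp only [hb, hψ]
      subst hm'
      rw [show (2 * m + 1 + 1) / 2 = m + 1 by omega, fourierEntry_last]
      ring
    rw [show Finset.range n = Finset.range (2 * m + 2) by rw [hm'], Finset.sum_range_succ,
      sum_range_two_mul_add_one, sum_range_symm_even (by rwa [hm'] at hsym), hb0, hlast, mul_add,
      mul_add, Finset.mul_sum]
    congr 2
    refine Finset.sum_congr rfl fun j hj => hbj j ?_ ?_ <;>
    · have := Finset.mem_range.1 hj
      omega
  · rw [show Finset.range n = Finset.range (2 * m + 1) by rw [hm],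
      sum_range_two_mul_add_one, sum_range_symm_odd (by rwa [hm] at hsym), hb0, mul_add,
      Finset.mul_sum]
    congr 1
    refine Finset.sum_congr rfl fun j hj => hbj j ?_ ?_ <;>
    · rintro ⟨he, -⟩
      exact (Nat.not_even_iff_odd.2 ⟨m, hm⟩) he

lemma fourierMatrix_transpose_mul_self {n : ℕ} :
    (fourierMatrix n)ᵀ * fourierMatrix n = 1 := by
  rcases Nat.eq_zero_or_pos n with rfl | hn
  · ext i
    exact i.elim0
  ext s t
  -- With `g = 1` the circulant formula becomes the orthogonality relation of the roots of unity.
  have h1 := sum_freqDiag_mul_fourierMatrix hn (g := fun _ => 1) (fun _ => rfl) s t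
  simp only [freqDiag, one_mul] at h1
  rw [Matrix.mul_apply]
  simp only [Matrix.transpose_apply]
  rw [h1, inv_mul_sum_cos_fourierFreq hn, Matrix.one_apply]
  congr 1
  rw [eq_iff_iff]
  constructor
  · intro hd
    have := Int.eq_zero_of_abs_lt_dvd hd (by rw [abs_lt]; omega)
    ext
    omega
  · rintro rfl
    simp

lemma fourierMatrix_mul_transpose_self {n : ℕ} :
    fourierMatrix n * (fourierMatrix n)ᵀ = 1 :=
  mul_eq_one_comm.1 fourierMatrix_transpose_mul_self

/-! ### Spectral densities and circulant approximation -/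

/-- The exponent `α > 1` enters the proof only here, through `|k| ≤ |k|^α` for nonzero integers. -/
lemma SpectralAssumption.summable_mul_abs {γ : ℤ → ℝ} (h : SpectralAssumption γ) :
    Summable fun k : ℤ => |(k : ℝ)| * |γ k| := by
  obtain ⟨⟨α, hα, hs⟩, -⟩ := h
  refine hs.of_nonneg_of_le (fun k => by positivity) fun k => ?_
  refine mul_le_mul_of_nonneg_right ?_ (abs_nonneg _)
  rcases eq_or_ne k 0 with rfl | hk
  · simpa using Real.rpow_nonneg le_rfl α
  · have h1 : (1 : ℝ) ≤ |(k : ℝ)| := by exact_mod_cast Int.one_le_abs hk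
    simpa using Real.rpow_le_rpow_of_exponent_le h1 hα.le

lemma SpectralAssumption.summable_abs {γ : ℤ → ℝ} (h : SpectralAssumption γ) :
    Summable fun k : ℤ => |γ k| := by
  refine (h.summable_mul_abs.add (hasSum_ite_eq (0 : ℤ) |γ 0|).summable).of_nonneg_of_le
    (fun k => abs_nonneg _) fun k => ?_
  rcases eq_or_ne k 0 with rfl | hk
  · simp
  · have h1 : (1 : ℝ) ≤ |(k : ℝ)| := by exact_mod_cast Int.one_le_abs hk
    simp only [hk, if_false, add_zero]
    exact le_mul_of_one_le_left (abs_nonneg _) h1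

lemma summable_mul_cos {γ : ℤ → ℝ} (h : Summable fun k : ℤ => |γ k|) (x : ℝ) :
    Summable fun k : ℤ => γ k * Real.cos (k * x) := by
  refine Summable.of_norm_bounded h fun k => ?_
  rw [Real.norm_eq_abs, abs_mul]
  exact mul_le_of_le_one_right (abs_nonneg _) (Real.abs_cos_le_one _)

lemma two_pi_mul_spectralDensity {γ : ℤ → ℝ} (h : Summable fun k : ℤ => |γ k|) (x : ℝ) :
    2 * Real.pi * spectralDensity γ x = ∑' k : ℤ, γ k * Real.cos (k * x) := by
  have hnorm : ∀ k : ℤ, ‖(γ k : ℂ) * Complex.exp (-Complex.I * (k : ℂ) * (x : ℂ))‖ = |γ k| := by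
    intro k
    rw [show -Complex.I * (k : ℂ) * (x : ℂ) = ((-(k * x) : ℝ) : ℂ) * Complex.I by
      push_cast; ring, norm_mul, Complex.norm_exp_ofReal_mul_I, mul_one, Complex.norm_real,
      Real.norm_eq_abs]
  have hs : Summable fun k : ℤ => (γ k : ℂ) * Complex.exp (-Complex.I * (k : ℂ) * (x : ℂ)) :=
    Summable.of_norm (by simpa only [hnorm] using h)
  have hre : ∀ k : ℤ, ((γ k : ℂ) * Complex.exp (-Complex.I * (k : ℂ) * (x : ℂ))).re
      = γ k * Real.cos (k * x) := by
    intro k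
    rw [show -Complex.I * (k : ℂ) * (x : ℂ) = ((-(k * x) : ℝ) : ℂ) * Complex.I by
      push_cast; ring, Complex.re_ofReal_mul, Complex.exp_ofReal_mul_I_re, Real.cos_neg]
  unfold spectralDensity
  rw [show (1 / (2 * (Real.pi : ℂ))) = ((1 / (2 * Real.pi) : ℝ) : ℂ) by push_cast; ring,
    Complex.re_ofReal_mul, Complex.re_tsum hs]
  simp only [hre]
  rw [← mul_assoc, mul_one_div_cancel (by positivity), one_mul]

lemma spectralDensity_two_pi_sub {γ : ℤ → ℝ} (h : Summable fun k : ℤ => |γ k|) (x : ℝ) :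
    spectralDensity γ (2 * Real.pi - x) = spectralDensity γ x := by
  have h2 : (2 * Real.pi) ≠ 0 := by positivity
  apply mul_left_cancel₀ h2
  rw [two_pi_mul_spectralDensity h, two_pi_mul_spectralDensity h]
  refine tsum_congr fun k => ?_
  rw [mul_sub, Real.cos_int_mul_two_pi_sub]

lemma two_pi_mul_spectralDensity_le {γ : ℤ → ℝ} (h : Summable fun k : ℤ => |γ k|) (x : ℝ) :
    2 * Real.pi * spectralDensity γ x ≤ ∑' k, |γ k| := by
  rw [two_pi_mul_spectralDensity h]
  refine (summable_mul_cos h x).tsum_le_tsum (fun k => ?_) h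
  refine (le_abs_self _).trans ?_
  rw [abs_mul]
  exact mul_le_of_le_one_right (abs_nonneg _) (Real.abs_cos_le_one _)

/-- The frequencies lie in `[0, 2π]`; those beyond `π` are reflected into `[0, π]`, where the lower
bound is assumed. -/
lemma le_spectralDensity_fourierFreq {γ : ℤ → ℝ} (h : Summable fun k : ℤ => |γ k|) {β : ℝ}
    (hβ : ∀ x ∈ Set.Icc (-Real.pi) Real.pi, β ≤ spectralDensity γ x) {n j : ℕ} (hj : j ≤ n) :
    β ≤ spectralDensity γ (fourierFreq n j) := by
  have hpi := Real.pi_pos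
  have h0 : 0 ≤ fourierFreq n j := by unfold fourierFreq; positivity
  have h1 : fourierFreq n j ≤ 2 * Real.pi := by
    unfold fourierFreq
    rw [mul_div_assoc]
    refine mul_le_of_le_one_right (by positivity) (div_le_one_of_le₀ ?_ (Nat.cast_nonneg n))
    exact_mod_cast hj
  rcases le_total (fourierFreq n j) Real.pi with h2 | h2
  · exact hβ _ ⟨by linarith, h2⟩
  · rw [← spectralDensity_two_pi_sub h]
    exact hβ _ ⟨by linarith, by linarith⟩

/-- The entries of the circulant matrix with eigenvalues `2π f(λ_j)`: aliasing of `γ`. -/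
noncomputable def aliasedCov (γ : ℤ → ℝ) (n : ℕ) (h : ℤ) : ℝ :=
  ∑' k : ℤ, if (n : ℤ) ∣ k - h then γ k else 0

lemma summable_ite_of_abs {γ : ℤ → ℝ} (h : Summable fun k : ℤ => |γ k|) (p : ℤ → Prop)
    [DecidablePred p] : Summable fun k : ℤ => if p k then γ k else 0 := by
  refine Summable.of_norm_bounded h fun k => ?_
  split_ifs <;> simp

lemma inv_mul_sum_spectralDensity_mul_cos {γ : ℤ → ℝ} (hs : Summable fun k : ℤ => |γ k|)
    (heven : ∀ k, γ (-k) = γ k) {n : ℕ} (hn : 0 < n) (h : ℤ) :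
    (n : ℝ)⁻¹ * ∑ j ∈ Finset.range n, 2 * Real.pi * spectralDensity γ (fourierFreq n j)
      * Real.cos (h * fourierFreq n j) = aliasedCov γ n h := by
  have h1 : ∀ j, 2 * Real.pi * spectralDensity γ (fourierFreq n j)
      * Real.cos (h * fourierFreq n j)
      = ∑' k : ℤ, γ k * Real.cos (k * fourierFreq n j) * Real.cos (h * fourierFreq n j) := by
    intro j
    rw [two_pi_mul_spectralDensity hs, tsum_mul_right]
  simp only [h1]
  rw [← Summable.tsum_finsetSum fun j _ => (summable_mul_cos hs _).mul_right _, ← tsum_mul_left]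
  -- The product-to-sum formula and orthogonality leave the residue classes of `h` and `-h` with
  -- weight 1/2 each; they agree because `γ` is even.
  have h2 : ∀ k : ℤ, (n : ℝ)⁻¹ * ∑ j ∈ Finset.range n,
      γ k * Real.cos (k * fourierFreq n j) * Real.cos (h * fourierFreq n j)
      = (1 / 2) * (if (n : ℤ) ∣ k - h then γ k else 0)
        + (1 / 2) * (if (n : ℤ) ∣ k + h then γ k else 0) := by
    intro k
    have e1 := inv_mul_sum_cos_fourierFreq hn (k - h)
    have e2 := inv_mul_sum_cos_fourierFreq hn (k + h)
    have e3 : ∀ j, γ k * Real.cos (k * fourierFreq n j) * Real.cos (h * fourierFreq n j)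
        = γ k / 2 * (Real.cos (((k - h : ℤ) : ℝ) * fourierFreq n j)
          + Real.cos (((k + h : ℤ) : ℝ) * fourierFreq n j)) := by
      intro j
      push_cast
      rw [sub_mul, add_mul, Real.cos_sub, Real.cos_add]
      ring
    simp only [e3]
    rw [← Finset.mul_sum, Finset.sum_add_distrib, mul_left_comm, mul_add, e1, e2]
    split_ifs <;> ring
  simp only [h2]
  rw [Summable.tsum_add ((summable_ite_of_abs hs _).mul_left _)
    ((summable_ite_of_abs hs _).mul_left _), tsum_mul_left, tsum_mul_left]
  have h3 : (∑' k : ℤ, if (n : ℤ) ∣ k + h then γ k else 0) = aliasedCov γ n h := by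
    unfold aliasedCov
    rw [← (Equiv.neg ℤ).tsum_eq]
    refine tsum_congr fun k => ?_
    have : (n : ℤ) ∣ -k + h ↔ (n : ℤ) ∣ k - h := by
      rw [← dvd_neg]
      ring_nf
    simp only [Equiv.neg_apply, this, heven]
  rw [h3]
  unfold aliasedCov
  ring

/-- For fixed `k`, only `k = h` survives once `n > |k - h|`; dominated convergence does the rest. -/
lemma tendsto_aliasedCov {γ : ℤ → ℝ} (hs : Summable fun k : ℤ => |γ k|) (h : ℤ) :
    Tendsto (fun n : ℕ => aliasedCov γ n h) atTop (𝓝 (γ h)) := by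
  have h1 : γ h = ∑' k : ℤ, if k = h then γ k else 0 := by
    rw [tsum_eq_single h fun k hk => if_neg hk]
    simp
  rw [h1]
  refine tendsto_tsum_of_dominated_convergence hs (fun k => ?_) (Eventually.of_forall fun n k => ?_)
  · refine tendsto_const_nhds.congr' ?_
    filter_upwards [eventually_gt_atTop (k - h).natAbs] with n hn
    have : (n : ℤ) ∣ k - h ↔ k = h := by
      constructor
      · intro hd
        have := Int.eq_zero_of_abs_lt_dvd hd (by rw [Int.abs_eq_natAbs]; omega)
        omega
      · rintro rfl
        simp
    simp only [this]
  · split_ifs <;> simp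

/-! ### Quadratic forms of Toeplitz and circulant matrices. -/

lemma sum_sum_mul_cos {n : ℕ} (v : Fin n → ℝ) (x : ℝ) :
    ∑ s, ∑ t, v s * v t * Real.cos (((s : ℤ) - (t : ℤ) : ℤ) * x)
      = (∑ s, v s * Real.cos ((s : ℕ) * x)) ^ 2 + (∑ s, v s * Real.sin ((s : ℕ) * x)) ^ 2 := by
  rw [sq, sq, Finset.sum_mul_sum, Finset.sum_mul_sum, ← Finset.sum_add_distrib]
  refine Finset.sum_congr rfl fun s _ => ?_
  rw [← Finset.sum_add_distrib]
  refine Finset.sum_congr rfl fun t _ => ?_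
  push_cast
  rw [sub_mul, Real.cos_sub]
  ring

lemma sum_sum_mul_cos_transform {n : ℕ} (v : Fin n → ℝ) (N : ℕ) (g : ℝ → ℝ) :
    ∑ s, ∑ t, v s * v t * ((N : ℝ)⁻¹ * ∑ j ∈ Finset.range N,
      g (fourierFreq N j) * Real.cos (((s : ℤ) - (t : ℤ) : ℤ) * fourierFreq N j))
      = (N : ℝ)⁻¹ * ∑ j ∈ Finset.range N, g (fourierFreq N j) *
        ∑ s, ∑ t, v s * v t * Real.cos (((s : ℤ) - (t : ℤ) : ℤ) * fourierFreq N j) := by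
  simp only [Finset.mul_sum]
  rw [Finset.sum_congr rfl fun s _ => Finset.sum_comm, Finset.sum_comm]
  exact Finset.sum_congr rfl fun j _ => Finset.sum_congr rfl fun s _ =>
    Finset.sum_congr rfl fun t _ => by ring

/-- The Toeplitz quadratic form of `γ` is bounded below by the minimum of `2πf`. -/
lemma two_pi_mul_sum_sq_le_toeplitz {γ : ℤ → ℝ} (hs : Summable fun k : ℤ => |γ k|)
    (heven : ∀ k, γ (-k) = γ k) {β : ℝ}
    (hβ : ∀ x ∈ Set.Icc (-Real.pi) Real.pi, β ≤ spectralDensity γ x) {n : ℕ} (v : Fin n → ℝ) :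
    2 * Real.pi * β * ∑ t, v t ^ 2 ≤ ∑ s, ∑ t, v s * v t * γ ((s : ℤ) - (t : ℤ)) := by
  -- The `n × n` Toeplitz form is a limit of aliased forms of period `N → ∞`. This replaces the
  -- integral representation of `γ`: for each `N` the bound compares finite sums with nonnegative
  -- weights.
  have hlim : Tendsto (fun N : ℕ => ∑ s, ∑ t, v s * v t * aliasedCov γ N ((s : ℤ) - (t : ℤ)))
      atTop (𝓝 (∑ s, ∑ t, v s * v t * γ ((s : ℤ) - (t : ℤ)))) :=
    tendsto_finsetSum _ fun s _ => tendsto_finsetSum _ fun t _ =>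
      (tendsto_aliasedCov hs _).const_mul _
  refine ge_of_tendsto hlim ?_
  filter_upwards [eventually_ge_atTop n, eventually_gt_atTop 0] with N hN hN0
  have h1 : ∑ s, ∑ t, v s * v t * aliasedCov γ N ((s : ℤ) - (t : ℤ))
      = (N : ℝ)⁻¹ * ∑ j ∈ Finset.range N, (2 * Real.pi * spectralDensity γ (fourierFreq N j)) *
        ∑ s, ∑ t, v s * v t * Real.cos (((s : ℤ) - (t : ℤ) : ℤ) * fourierFreq N j) := by
    rw [← sum_sum_mul_cos_transform v N fun x => 2 * Real.pi * spectralDensity γ x]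
    simp only [inv_mul_sum_spectralDensity_mul_cos hs heven hN0]
  -- Since `N ≥ n`, all differences satisfy `|s - t| < N`, so a constant spectrum contributes on the
  -- diagonal only.
  have h2 : 2 * Real.pi * β * ∑ t, v t ^ 2
      = (N : ℝ)⁻¹ * ∑ j ∈ Finset.range N, (2 * Real.pi * β) *
        ∑ s, ∑ t, v s * v t * Real.cos (((s : ℤ) - (t : ℤ) : ℤ) * fourierFreq N j) := by
    rw [← sum_sum_mul_cos_transform v N fun _ => 2 * Real.pi * β, Finset.mul_sum]
    refine Finset.sum_congr rfl fun s _ => ?_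
    rw [Finset.sum_eq_single s]
    · rw [← Finset.mul_sum, mul_left_comm _ (2 * Real.pi * β), inv_mul_sum_cos_fourierFreq hN0]
      simp
      ring
    · intro t _ hts
      rw [← Finset.mul_sum, mul_left_comm _ (2 * Real.pi * β), inv_mul_sum_cos_fourierFreq hN0,
        if_neg, mul_zero, mul_zero]
      intro hd
      have := Int.eq_zero_of_abs_lt_dvd hd (by rw [abs_lt]; omega)
      apply hts
      ext
      omega
    · simp
  rw [h1, h2]
  gcongr with j hj
  · rw [sum_sum_mul_cos]
    positivity
  · exact le_spectralDensity_fourierFreq hs hβ (Finset.mem_range.1 hj).le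

/-- The column `t` determines `s` modulo `n`, and `s - t ≠ k` forces `t + k` to leave `[0, n)`. That
leaves at most `|k|` columns: the last ones if `k ≥ 0`, the first ones if `k ≤ 0`. -/
lemma card_aliased_le (n : ℕ) (k : ℤ) :
    (Finset.univ.filter fun p : Fin n × Fin n =>
      (n : ℤ) ∣ k - ((p.1 : ℤ) - (p.2 : ℤ)) ∧ k ≠ (p.1 : ℤ) - (p.2 : ℤ)).card ≤ k.natAbs := by
  rw [← Finset.card_range k.natAbs]
  have huniq : ∀ p q : Fin n × Fin n, (n : ℤ) ∣ k - ((p.1 : ℤ) - (p.2 : ℤ)) →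
      (n : ℤ) ∣ k - ((q.1 : ℤ) - (q.2 : ℤ)) → p.2 = q.2 → p = q := by
    rintro ⟨s, t⟩ ⟨s', t'⟩ h1 h2 rfl
    have h3 := dvd_sub h1 h2
    have h4 := Int.eq_zero_of_abs_lt_dvd h3 (by simp only [abs_lt]; omega)
    ext
    · simp only at h4 ⊢
      omega
    · rfl
  have hrange : ∀ p : Fin n × Fin n, (n : ℤ) ∣ k - ((p.1 : ℤ) - (p.2 : ℤ)) →
      k ≠ (p.1 : ℤ) - (p.2 : ℤ) → (p.2 : ℤ) + k < 0 ∨ (n : ℤ) ≤ p.2 + k := by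
    rintro ⟨s, t⟩ h1 h2
    by_contra hcon
    push Not at hcon
    simp only at h1 h2 hcon
    have := Int.eq_zero_of_abs_lt_dvd h1 (by simp only [abs_lt]; omega)
    omega
  rcases le_total 0 k with hk | hk
  · refine Finset.card_le_card_of_injOn (fun p => n - 1 - (p.2 : ℕ)) ?_ ?_
    · intro p hp
      simp only [Finset.coe_filter, Finset.mem_univ, true_and, Set.mem_ofPred_eq] at hp
      have := hrange p hp.1 hp.2
      simp only [Finset.coe_range, Set.mem_Iio]
      omega
    · intro p hp q hq hpq
      simp only [Finset.coe_filter, Finset.mem_univ, true_and, Set.mem_ofPred_eq] at hp hq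
      refine huniq p q hp.1 hq.1 ?_
      simp only at hpq
      ext
      omega
  · refine Finset.card_le_card_of_injOn (fun p => (p.2 : ℕ)) ?_ ?_
    · intro p hp
      simp only [Finset.coe_filter, Finset.mem_univ, true_and, Set.mem_ofPred_eq] at hp
      have := hrange p hp.1 hp.2
      simp only [Finset.coe_range, Set.mem_Iio]
      omega
    · intro p hp q hq hpq
      simp only [Finset.coe_filter, Finset.mem_univ, true_and, Set.mem_ofPred_eq] at hp hq
      exact huniq p q hp.1 hq.1 (Fin.ext hpq)

/-- The Frobenius distance between the Toeplitz and the circulant matrix is bounded. -/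
lemma sum_sq_sub_aliasedCov_le {γ : ℤ → ℝ} (hs : Summable fun k : ℤ => |γ k|)
    (hs' : Summable fun k : ℤ => |(k : ℝ)| * |γ k|) (n : ℕ) :
    ∑ s : Fin n, ∑ t : Fin n,
        (γ ((s : ℤ) - (t : ℤ)) - aliasedCov γ n ((s : ℤ) - (t : ℤ))) ^ 2
      ≤ (∑' k, |γ k|) * ∑' k : ℤ, |(k : ℝ)| * |γ k| := by
  have habs : Summable fun k : ℤ => |(|γ k|)| := by simpa using hs
  set G := ∑' k, |γ k| with hG
  have hG0 : 0 ≤ G := tsum_nonneg fun k => abs_nonneg _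
  -- One factor of the square is bounded by `G`, so that the other is linear in `|γ k|` and the sums
  -- over positions and over `k` can be exchanged.
  have hdiff : ∀ h : ℤ, (γ h - aliasedCov γ n h) ^ 2
      ≤ G * ∑' k : ℤ, if (n : ℤ) ∣ k - h ∧ k ≠ h then |γ k| else 0 := by
    intro h
    set D := ∑' k : ℤ, if (n : ℤ) ∣ k - h ∧ k ≠ h then |γ k| else 0 with hD
    have hD0 : 0 ≤ D := tsum_nonneg fun k => by split_ifs <;> simp
    have hDG : D ≤ G := (summable_ite_of_abs habs _).tsum_le_tsum
      (fun k => by split_ifs <;> simp) hs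
    have h1 : aliasedCov γ n h - γ h
        = ∑' k : ℤ, if (n : ℤ) ∣ k - h ∧ k ≠ h then γ k else 0 := by
      have h2 : γ h = ∑' k : ℤ, if k = h then γ k else 0 := by
        rw [tsum_eq_single h fun k hk => if_neg hk]
        simp
      rw [aliasedCov, h2, ← (summable_ite_of_abs hs _).tsum_sub (summable_ite_of_abs hs _)]
      refine tsum_congr fun k => ?_
      by_cases hk : k = h
      · simp [hk]
      · simp [hk]
    have h3 : |aliasedCov γ n h - γ h| ≤ D := by
      rw [h1, ← Real.norm_eq_abs]
      refine tsum_of_norm_bounded (summable_ite_of_abs habs _).hasSum fun k => ?_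
      split_ifs <;> simp
    rw [← neg_sq, neg_sub, ← sq_abs, sq]
    exact mul_le_mul (h3.trans hDG) h3 (abs_nonneg _) hG0
  calc _ ≤ ∑ s : Fin n, ∑ t : Fin n, G * ∑' k : ℤ,
        if (n : ℤ) ∣ k - ((s : ℤ) - (t : ℤ)) ∧ k ≠ (s : ℤ) - (t : ℤ) then |γ k| else 0 :=
      Finset.sum_le_sum fun s _ => Finset.sum_le_sum fun t _ => hdiff _
    _ = G * ∑' k : ℤ, ∑ p : Fin n × Fin n,
        if (n : ℤ) ∣ k - ((p.1 : ℤ) - (p.2 : ℤ)) ∧ k ≠ (p.1 : ℤ) - (p.2 : ℤ)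
          then |γ k| else 0 := by
      rw [Summable.tsum_finsetSum fun p _ => summable_ite_of_abs habs _, ← Fintype.sum_prod_type',
        Finset.mul_sum]
    _ ≤ _ := by
      refine mul_le_mul_of_nonneg_left ?_ hG0
      refine Summable.tsum_le_tsum (fun k => ?_)
        (summable_sum fun p _ => summable_ite_of_abs habs _) hs'
      rw [← Finset.sum_filter, Finset.sum_const, nsmul_eq_mul]
      refine mul_le_mul_of_nonneg_right ?_ (abs_nonneg _)
      rw [← Int.cast_abs, Int.abs_eq_natAbs]
      exact_mod_cast card_aliased_le n k

/-! ### The Whittle law as a Gaussian law -/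

lemma periodogram_eq {n : ℕ} (z : Fin n → ℝ) (x : ℝ) :
    periodogram n z x = 1 / (2 * Real.pi * n)
      * ∑ s, ∑ t, z s * z t * Real.cos (((s : ℤ) - (t : ℤ) : ℤ) * x) := by
  have hterm : ∀ t : Fin n, (z t : ℂ) * Complex.exp (-Complex.I * ((t : ℕ) + 1 : ℂ) * (x : ℂ))
      = (z t : ℂ) * Complex.exp (((-(((t : ℕ) + 1) * x) : ℝ) : ℂ) * Complex.I) := by
    intro t
    congr 2
    push_cast
    ring
  unfold periodogram
  rw [Complex.sq_norm, Complex.normSq_apply, Complex.re_sum, Complex.im_sum]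
  simp only [hterm, Complex.re_ofReal_mul, Complex.im_ofReal_mul, Complex.exp_ofReal_mul_I_re,
    Complex.exp_ofReal_mul_I_im, Real.cos_neg, Real.sin_neg]
  congr 1
  rw [Finset.sum_mul_sum, Finset.sum_mul_sum, ← Finset.sum_add_distrib]
  refine Finset.sum_congr rfl fun s _ => ?_
  rw [← Finset.sum_add_distrib]
  refine Finset.sum_congr rfl fun t _ => ?_
  have hc : Real.cos (((s : ℤ) - (t : ℤ) : ℤ) * x)
      = Real.cos ((((s : ℕ) : ℝ) + 1) * x - (((t : ℕ) : ℝ) + 1) * x) := by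
    congr 1
    push_cast
    ring
  rw [hc, Real.cos_sub]
  ring

/-- Identifies the Whittle exponent with the quadratic form of the inverse circulant covariance. -/
lemma sum_periodogram_div {f : ℝ → ℝ} (hf : ∀ x, f (2 * Real.pi - x) = f x) {n : ℕ}
    (z : Fin n → ℝ) :
    ∑ j ∈ Finset.range n, periodogram n z (fourierFreq n j) / f (fourierFreq n j)
      = ∑ i, freqDiag (fun x => (2 * Real.pi * f x)⁻¹) n i * (fourierMatrix n *ᵥ z) i ^ 2 := by
  have h1 := sum_sum_mul_cos_transform z n fun x => (2 * Real.pi * f x)⁻¹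
  have h2 : ∑ j ∈ Finset.range n, periodogram n z (fourierFreq n j) / f (fourierFreq n j)
      = (n : ℝ)⁻¹ * ∑ j ∈ Finset.range n, (2 * Real.pi * f (fourierFreq n j))⁻¹ *
        ∑ s, ∑ t, z s * z t * Real.cos (((s : ℤ) - (t : ℤ) : ℤ) * fourierFreq n j) := by
    rw [Finset.mul_sum]
    refine Finset.sum_congr rfl fun j _ => ?_
    rw [periodogram_eq, div_eq_mul_inv, one_div, mul_inv, mul_inv]
    ring
  rw [h2, ← h1]
  have h3 : ∀ s t : Fin n, (n : ℝ)⁻¹ * ∑ j ∈ Finset.range n, (2 * Real.pi * f (fourierFreq n j))⁻¹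
      * Real.cos (((s : ℤ) - (t : ℤ) : ℤ) * fourierFreq n j)
      = ∑ i, freqDiag (fun x => (2 * Real.pi * f x)⁻¹) n i
        * (fourierMatrix n i s * fourierMatrix n i t) := fun s t =>
    (sum_freqDiag_mul_fourierMatrix (g := fun x => (2 * Real.pi * f x)⁻¹) s.pos
      (fun x => by simp only [hf]) s t).symm
  simp only [h3, Finset.mul_sum]
  rw [Finset.sum_congr rfl fun s _ => Finset.sum_comm, Finset.sum_comm]
  refine Finset.sum_congr rfl fun i _ => ?_
  rw [Matrix.mulVec, dotProduct, sq, Finset.sum_mul_sum, Finset.mul_sum]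
  refine Finset.sum_congr rfl fun s _ => ?_
  rw [Finset.mul_sum]
  exact Finset.sum_congr rfl fun t _ => by ring

/-- The matrix that standardizes the Whittle law with spectral density `f`. -/
noncomputable def whiteningMatrix (f : ℝ → ℝ) (n : ℕ) : Matrix (Fin n) (Fin n) ℝ :=
  Matrix.diagonal (fun i => (√(freqDiag (fun x => 2 * Real.pi * f x) n i))⁻¹) * fourierMatrix n

lemma whiteningMatrix_mulVec (f : ℝ → ℝ) {n : ℕ} (z : Fin n → ℝ) (i : Fin n) :
    (whiteningMatrix f n *ᵥ z) i
      = (√(freqDiag (fun x => 2 * Real.pi * f x) n i))⁻¹ * (fourierMatrix n *ᵥ z) i := by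
  rw [whiteningMatrix, ← Matrix.mulVec_mulVec, Matrix.mulVec_diagonal]

lemma freqDiag_pos {f : ℝ → ℝ} {n : ℕ} (hf : ∀ j ≤ n, 0 < f (fourierFreq n j)) (i : Fin n) :
    0 < freqDiag f n i :=
  hf _ (by omega)

lemma freqDiag_two_pi_pos {f : ℝ → ℝ} {n : ℕ} (hf : ∀ j ≤ n, 0 < f (fourierFreq n j))
    (i : Fin n) : 0 < freqDiag (fun x => 2 * Real.pi * f x) n i :=
  mul_pos (by positivity) (freqDiag_pos hf i)

lemma whittleLaw_eq {f : ℝ → ℝ} (hf : ∀ x, f (2 * Real.pi - x) = f x) {n : ℕ}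
    (hpos : ∀ j ≤ n, 0 < f (fourierFreq n j)) :
    whittleLaw f n = normalizedLaw fun z => gaussianKernel (whiteningMatrix f n *ᵥ z) := by
  have hm : Measurable fun z : Fin n → ℝ => gaussianKernel (whiteningMatrix f n *ᵥ z) :=
    measurable_gaussianKernel.comp (measurable_mulVec_const _)
  rw [← normalizedLaw_const_mul (c := ENNReal.ofReal (Real.exp (-(1 / 2) *
    ∑ j ∈ Finset.range n, Real.log (f (fourierFreq n j))))) (by simpa using Real.exp_pos _)
    ENNReal.ofReal_ne_top hm, whittleLaw]
  congr 1
  ext z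
  rw [gaussianKernel, ← ENNReal.ofReal_mul (Real.exp_pos _).le, ← Real.exp_add, ← mul_add,
    Finset.sum_add_distrib, sum_periodogram_div hf]
  congr 5
  ext i
  rw [whiteningMatrix_mulVec, mul_pow, inv_pow, Real.sq_sqrt (freqDiag_two_pi_pos hpos i).le]
  rfl

lemma gaussianKernel_mulVec {n : ℕ} {U : Matrix (Fin n) (Fin n) ℝ} (hU : Uᵀ * U = 1)
    (y : Fin n → ℝ) : gaussianKernel (U *ᵥ y) = gaussianKernel y := by
  have h : ∀ x : Fin n → ℝ, ∑ i, x i ^ 2 = x ⬝ᵥ x := fun x =>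
    Finset.sum_congr rfl fun i _ => sq _
  rw [gaussianKernel, gaussianKernel, h, h, Matrix.dotProduct_mulVec, Matrix.vecMul_mulVec, hU,
    Matrix.vecMul_one]

/-- Whitening is unique only up to a rotation; the free `U` can be chosen to diagonalize the other
covariance as well. -/
lemma map_whittleLaw {f : ℝ → ℝ} (hf : ∀ x, f (2 * Real.pi - x) = f x) {n : ℕ}
    (hpos : ∀ j ≤ n, 0 < f (fourierFreq n j)) {U B : Matrix (Fin n) (Fin n) ℝ} (hU : Uᵀ * U = 1)
    (hB : U * whiteningMatrix f n * B = 1) :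
    (whittleLaw f n).map (fun z => (U * whiteningMatrix f n) *ᵥ z)
      = Measure.pi fun _ => gaussianReal 0 1 := by
  rw [whittleLaw_eq hf hpos, ← normalizedLaw_gaussianKernel,
    ← map_normalizedLaw_mulVec hB one_ne_zero ENNReal.one_ne_top measurable_gaussianKernel]
  congr 2
  ext z
  rw [one_mul, ← Matrix.mulVec_mulVec, gaussianKernel_mulVec hU]

lemma whittleLaw_absolutelyContinuous (f : ℝ → ℝ) (n : ℕ) : whittleLaw f n ≪ volume :=
  (withDensity_absolutelyContinuous _ _).smul_left _

/-! ### Frobenius norms -/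

lemma trace_mul_transpose_self {n : ℕ} (X : Matrix (Fin n) (Fin n) ℝ) :
    (X * Xᵀ).trace = ∑ i, ∑ j, X i j ^ 2 := by
  simp [Matrix.trace, Matrix.mul_apply, sq]

lemma sum_sq_conj {n : ℕ} {V : Matrix (Fin n) (Fin n) ℝ} (hV : Vᵀ * V = 1)
    (X : Matrix (Fin n) (Fin n) ℝ) :
    ∑ i, ∑ j, (V * X * Vᵀ) i j ^ 2 = ∑ i, ∑ j, X i j ^ 2 := by
  rw [← trace_mul_transpose_self, ← trace_mul_transpose_self]
  have : V * X * Vᵀ * (V * X * Vᵀ)ᵀ = V * (X * Xᵀ * Vᵀ) := by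
    rw [Matrix.transpose_mul, Matrix.transpose_mul, Matrix.transpose_transpose]
    calc V * X * Vᵀ * (V * (Xᵀ * Vᵀ)) = V * X * (Vᵀ * V) * (Xᵀ * Vᵀ) := by
          simp only [Matrix.mul_assoc]
      _ = _ := by rw [hV, Matrix.mul_one]; simp only [Matrix.mul_assoc]
  rw [this, Matrix.trace_mul_comm, Matrix.mul_assoc, hV, Matrix.mul_one]

lemma exists_orthogonal_diagonalization {n : ℕ} {S : Matrix (Fin n) (Fin n) ℝ} (hS : Sᵀ = S) :
    ∃ (U : Matrix (Fin n) (Fin n) ℝ) (l : Fin n → ℝ), Uᵀ * U = 1 ∧ U * Uᵀ = 1 ∧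
      U * S * Uᵀ = Matrix.diagonal l := by
  have hH : S.IsHermitian := by
    rw [Matrix.IsHermitian, Matrix.conjTranspose_eq_transpose_of_trivial, hS]
  set W : Matrix (Fin n) (Fin n) ℝ := (hH.eigenvectorUnitary).1 with hW
  have hWs : star W = Wᵀ := Matrix.conjTranspose_eq_transpose_of_trivial W
  have h1 : Wᵀ * W = 1 := by
    rw [← hWs]
    exact Unitary.coe_star_mul_self hH.eigenvectorUnitary
  have h2 : W * Wᵀ = 1 := mul_eq_one_comm.1 h1
  have h3 : S = W * Matrix.diagonal hH.eigenvalues * Wᵀ := by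
    rw [← hWs]
    exact hH.spectral_theorem
  refine ⟨Wᵀ, hH.eigenvalues, by simpa using h2, by simpa using h1, ?_⟩
  rw [Matrix.transpose_transpose]
  conv_lhs => rw [h3]
  calc Wᵀ * (W * Matrix.diagonal hH.eigenvalues * Wᵀ) * W
      = (Wᵀ * W) * Matrix.diagonal hH.eigenvalues * (Wᵀ * W) := by
        simp only [Matrix.mul_assoc]
    _ = _ := by rw [h1, Matrix.one_mul, Matrix.mul_one]

/-! ### The law of the series -/

lemma IsStationaryGaussianSeries.even {Ω : Type*} [MeasurableSpace Ω] {P : Measure Ω}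
    {Z : ℕ → Ω → ℝ} {γ : ℤ → ℝ} (hZ : IsStationaryGaussianSeries P Z γ) (k : ℤ) :
    γ (-k) = γ k := by
  have key : ∀ s t : ℕ, γ ((s : ℤ) - t) = γ ((t : ℤ) - s) := fun s t => by
    rw [← hZ.autocov, ← hZ.autocov, covariance_comm]
  rcases Int.natAbs_eq k with h | h
  · have := key 0 k.natAbs
    rw [h]
    simpa using this
  · have := key k.natAbs 0
    rw [h]
    simpa using this

lemma IsStationaryGaussianSeries.hasGaussianLaw {Ω : Type*} [MeasurableSpace Ω] {P : Measure Ω}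
    {Z : ℕ → Ω → ℝ} {γ : ℤ → ℝ} (hZ : IsStationaryGaussianSeries P Z γ) (n : ℕ) :
    HasGaussianLaw (fun ω (t : Fin n) => Z ((t : ℕ) + 1) ω) P := by
  classical
  have h := hZ.gaussian.hasGaussianLaw (Finset.range (n + 1))
  exact h.map (ContinuousLinearMap.pi fun t : Fin n =>
    ContinuousLinearMap.proj (R := ℝ) (φ := fun _ : Finset.range (n + 1) => ℝ)
      ⟨(t : ℕ) + 1, by simp⟩)

/-- The coordinates of `LZ` are jointly Gaussian and uncorrelated, hence independent. -/
lemma IsStationaryGaussianSeries.map_seriesLaw {Ω : Type*} [MeasurableSpace Ω] {P : Measure Ω}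
    [IsProbabilityMeasure P] {Z : ℕ → Ω → ℝ} {γ : ℤ → ℝ}
    (hZ : IsStationaryGaussianSeries P Z γ) {n : ℕ} {L : Matrix (Fin n) (Fin n) ℝ}
    {l : Fin n → ℝ}
    (hL : L * (Matrix.of fun s t : Fin n => γ ((s : ℤ) - t)) * Lᵀ = Matrix.diagonal l) :
    (seriesLaw P Z n).map (fun z => L *ᵥ z)
      = Measure.pi fun i => gaussianReal 0 (l i).toNNReal := by
  have hG := hZ.hasGaussianLaw n
  have hmem : ∀ t : Fin n, MemLp (Z ((t : ℕ) + 1)) 2 P := fun t =>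
    (hZ.gaussian.hasGaussianLaw_eval _).memLp_two
  set X : Fin n → Ω → ℝ := fun i ω => ∑ t, L i t * Z ((t : ℕ) + 1) ω with hX
  have hXlaw : HasGaussianLaw (fun ω i => X i ω) P :=
    hG.map (LinearMap.toContinuousLinearMap (Matrix.mulVecLin L))
  have hmean : ∀ i, ∫ ω, X i ω ∂P = 0 := by
    intro i
    simp only [hX]
    rw [integral_finsetSum _ fun t _ => ((hmem t).integrable one_le_two).const_mul _]
    exact Finset.sum_eq_zero fun t _ => by rw [integral_const_mul, hZ.mean_zero, mul_zero]
  have hcov : ∀ i j, cov[X i, X j; P] = Matrix.diagonal l i j := by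
    intro i j
    simp only [hX]
    rw [covariance_fun_sum_fun_sum (X := fun t ω => L i t * Z ((t : ℕ) + 1) ω)
      (Y := fun t ω => L j t * Z ((t : ℕ) + 1) ω) (fun t => (hmem t).const_mul _)
      (fun t => (hmem t).const_mul _), ← hL, Matrix.mul_apply, Finset.sum_comm]
    refine Finset.sum_congr rfl fun t _ => ?_
    rw [Matrix.mul_apply, Finset.sum_mul]
    refine Finset.sum_congr rfl fun s _ => ?_
    rw [covariance_const_mul_left, covariance_const_mul_right, hZ.autocov, Matrix.transpose_apply,
      Matrix.of_apply, ← hZ.even ((s : ℤ) - t)]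
    push_cast
    ring_nf
  have hindep : iIndepFun X P := hXlaw.iIndepFun_of_covariance_eq_zero fun i j hij => by
    rw [hcov, Matrix.diagonal_apply_ne _ hij]
  have hXm : ∀ i, AEMeasurable (X i) P := fun i => (hXlaw.eval i).aemeasurable
  rw [seriesLaw, AEMeasurable.map_map_of_aemeasurable (measurable_mulVec_const L).aemeasurable
    hG.aemeasurable]
  have hfun : ((fun z => L *ᵥ z) ∘ fun ω (t : Fin n) => Z ((t : ℕ) + 1) ω)
      = fun ω i => X i ω := rfl
  rw [hfun, (iIndepFun_iff_map_fun_eq_pi_map hXm).1 hindep]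
  congr 1
  ext1 i
  rw [(hXlaw.eval i).map_eq_gaussianReal, hmean, ← covariance_self (hXm i), hcov,
    Matrix.diagonal_apply_eq]

/-! ### Comparison of the law of the series with its Whittle law -/

/-- Simultaneous diagonalization of the Toeplitz matrix of `γ` and its circulant approximation. -/
lemma exists_simultaneous_diagonalization {γ : ℤ → ℝ} (hs : Summable fun k : ℤ => |γ k|)
    (hs' : Summable fun k : ℤ => |(k : ℝ)| * |γ k|) (heven : ∀ k, γ (-k) = γ k) {β : ℝ}
    (hβ0 : 0 < β) (hβ : ∀ x ∈ Set.Icc (-Real.pi) Real.pi, β ≤ spectralDensity γ x) (n : ℕ) :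
    ∃ (U B : Matrix (Fin n) (Fin n) ℝ) (l : Fin n → ℝ), Uᵀ * U = 1 ∧
      U * whiteningMatrix (spectralDensity γ) n * B = 1 ∧
      (U * whiteningMatrix (spectralDensity γ) n) * (Matrix.of fun s t : Fin n => γ ((s : ℤ) - t))
        * (U * whiteningMatrix (spectralDensity γ) n)ᵀ = Matrix.diagonal l ∧
      (∀ i, 2 * Real.pi * β / ∑' k, |γ k| ≤ l i) ∧
      ∑ i, (l i - 1) ^ 2
        ≤ (∑' k, |γ k|) * (∑' k : ℤ, |(k : ℝ)| * |γ k|) / (2 * Real.pi * β) ^ 2 := by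
  have hpi := Real.pi_pos
  set f := spectralDensity γ with hf
  have hfsymm : ∀ x, f (2 * Real.pi - x) = f x := spectralDensity_two_pi_sub hs
  set F := fourierMatrix n with hF
  have hF1 : Fᵀ * F = 1 := fourierMatrix_transpose_mul_self
  have hF2 : F * Fᵀ = 1 := fourierMatrix_mul_transpose_self
  set d := freqDiag (fun x => 2 * Real.pi * f x) n with hd
  have hdβ : ∀ i, 2 * Real.pi * β ≤ d i := fun i =>
    mul_le_mul_of_nonneg_left (le_spectralDensity_fourierFreq hs hβ (by omega)) (by positivity)
  have hd0 : ∀ i, 0 < d i := fun i => lt_of_lt_of_le (by positivity) (hdβ i)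
  set G := ∑' k, |γ k| with hG
  have hdG : ∀ i, d i ≤ G := fun i => two_pi_mul_spectralDensity_le hs _
  set Γ : Matrix (Fin n) (Fin n) ℝ := Matrix.of fun s t : Fin n => γ ((s : ℤ) - t) with hΓ
  have hΓt : Γᵀ = Γ := by
    ext s t
    rw [Matrix.transpose_apply, hΓ, Matrix.of_apply, Matrix.of_apply, ← heven, neg_sub]
  set D : Matrix (Fin n) (Fin n) ℝ := Fᵀ * Matrix.diagonal d * F with hD
  have hDentry : ∀ s t, D s t = aliasedCov γ n ((s : ℤ) - t) := by
    intro s t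
    rw [← inv_mul_sum_spectralDensity_mul_cos hs heven s.pos,
      ← sum_freqDiag_mul_fourierMatrix (g := fun x => 2 * Real.pi * f x) s.pos
        (fun x => by simp only [hfsymm]), hD, Matrix.mul_apply]
    refine Finset.sum_congr rfl fun i _ => ?_
    rw [Matrix.mul_diagonal, Matrix.transpose_apply]
    ring
  set W : Matrix (Fin n) (Fin n) ℝ := Matrix.diagonal fun i => (√(d i))⁻¹ with hW
  have hWt : Wᵀ = W := Matrix.diagonal_transpose _
  have hA : whiteningMatrix f n = W * F := rfl
  have hsq : ∀ i, √(d i) ≠ 0 := fun i => (Real.sqrt_pos.2 (hd0 i)).ne'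
  have hWW : W * Matrix.diagonal (fun i => √(d i)) = 1 := by
    rw [hW, Matrix.diagonal_mul_diagonal, ← Matrix.diagonal_one]
    congr 1
    ext i
    exact inv_mul_cancel₀ (hsq i)
  have hWD : W * Matrix.diagonal d * W = 1 := by
    rw [hW, Matrix.diagonal_mul_diagonal, Matrix.diagonal_mul_diagonal, ← Matrix.diagonal_one]
    congr 1
    ext i
    have := Real.mul_self_sqrt (hd0 i).le
    have h2 := hsq i
    field_simp
    rw [sq, this]
  -- `S` is the covariance of the series in the coordinates that whiten the circulant law; its
  -- eigenvalues are the `l i`.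
  set S := W * (F * Γ * Fᵀ) * W with hS
  have hSt : Sᵀ = S := by
    rw [hS]
    simp only [Matrix.transpose_mul, Matrix.transpose_transpose, hWt, hΓt, Matrix.mul_assoc]
  obtain ⟨U, l, hU1, hU2, hUS⟩ := exists_orthogonal_diagonalization hSt
  have hLS : U * (W * F) * Γ * (U * (W * F))ᵀ = Matrix.diagonal l := by
    rw [← hUS, hS]
    simp only [Matrix.transpose_mul, hWt, Matrix.mul_assoc]
  refine ⟨U, Fᵀ * Matrix.diagonal (fun i => √(d i)) * Uᵀ, l, hU1, ?_, by rw [hA]; exact hLS,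
    fun i => ?_, ?_⟩
  · calc U * whiteningMatrix f n * (Fᵀ * Matrix.diagonal (fun i => √(d i)) * Uᵀ)
        = U * (W * (F * Fᵀ) * Matrix.diagonal (fun i => √(d i))) * Uᵀ := by
          rw [hA]
          simp only [Matrix.mul_assoc]
      _ = 1 := by rw [hF2, Matrix.mul_one, hWW, Matrix.mul_one, hU2]
  · set L := U * (W * F) with hL
    -- `l i` is the Toeplitz form at row `i` of `L`. That row has squared norm at least `1/G`,
    -- because `U` has unit rows and `d ≤ G`.
    have h1 : l i = ∑ s, ∑ t, L i s * L i t * γ ((s : ℤ) - t) := by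
      have := congrFun (congrFun hLS i) i
      rw [Matrix.diagonal_apply_eq, Matrix.mul_apply] at this
      rw [← this, Finset.sum_comm]
      refine Finset.sum_congr rfl fun t _ => ?_
      rw [Matrix.mul_apply, Finset.sum_mul]
      refine Finset.sum_congr rfl fun s _ => ?_
      rw [Matrix.transpose_apply, hΓ, Matrix.of_apply]
      ring
    have h2 : ∑ t, L i t ^ 2 = ∑ k, U i k ^ 2 / d k := by
      have h3 : L * Lᵀ = U * W * (U * W)ᵀ := by
        calc L * Lᵀ = U * W * (F * Fᵀ) * (U * W)ᵀ := by
              rw [hL]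
              simp only [Matrix.transpose_mul, Matrix.mul_assoc]
          _ = _ := by rw [hF2, Matrix.mul_one]
      have h4 := congrFun (congrFun h3 i) i
      rw [Matrix.mul_apply, Matrix.mul_apply] at h4
      simp only [Matrix.transpose_apply, ← sq] at h4
      rw [h4]
      refine Finset.sum_congr rfl fun k _ => ?_
      rw [hW, Matrix.mul_diagonal, mul_pow, inv_pow, Real.sq_sqrt (hd0 k).le, div_eq_mul_inv]
    have h5 : ∑ k, U i k ^ 2 = 1 := by
      have h4 := congrFun (congrFun hU2 i) i
      rw [Matrix.mul_apply, Matrix.one_apply_eq] at h4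
      simpa only [Matrix.transpose_apply, ← sq] using h4
    have h6 : 1 / G ≤ ∑ t, L i t ^ 2 := by
      rw [h2, ← h5, Finset.sum_div]
      exact Finset.sum_le_sum fun k _ => div_le_div_of_nonneg_left (sq_nonneg _) (hd0 k) (hdG k)
    rw [h1]
    refine le_trans ?_ (two_pi_mul_sum_sq_le_toeplitz hs heven hβ (L i))
    rw [div_eq_mul_one_div]
    exact mul_le_mul_of_nonneg_left h6 (by positivity)
  · have h1 : ∑ i, (l i - 1) ^ 2 = ∑ i, ∑ j, (U * (S - 1) * Uᵀ) i j ^ 2 := by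
      have h2 : U * (S - 1) * Uᵀ = Matrix.diagonal fun i => l i - 1 := by
        rw [Matrix.mul_sub, Matrix.sub_mul, hUS, Matrix.mul_one, hU2, ← Matrix.diagonal_one,
          Matrix.diagonal_sub]
      rw [h2]
      refine Finset.sum_congr rfl fun i _ => ?_
      rw [Finset.sum_eq_single i]
      · rw [Matrix.diagonal_apply_eq]
      · intro j _ hji
        rw [Matrix.diagonal_apply_ne _ hji.symm]
        simp
      · simp
    have h3 : S - 1 = W * (F * (Γ - D) * Fᵀ) * W := by
      have h4 : F * D * Fᵀ = Matrix.diagonal d := by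
        calc F * D * Fᵀ = (F * Fᵀ) * Matrix.diagonal d * (F * Fᵀ) := by
              rw [hD]
              simp only [Matrix.mul_assoc]
          _ = _ := by rw [hF2, Matrix.one_mul, Matrix.mul_one]
      rw [Matrix.mul_sub, Matrix.sub_mul, h4, Matrix.mul_sub, Matrix.sub_mul, hWD]
    have h5 : ∀ i j, (S - 1) i j ^ 2 ≤ (F * (Γ - D) * Fᵀ) i j ^ 2 / (2 * Real.pi * β) ^ 2 := by
      intro i j
      rw [h3, hW, Matrix.mul_diagonal, Matrix.diagonal_mul, mul_pow, mul_pow, inv_pow, inv_pow,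
        Real.sq_sqrt (hd0 i).le, Real.sq_sqrt (hd0 j).le]
      have h6 : (d i)⁻¹ * (d j)⁻¹ ≤ ((2 * Real.pi * β) ^ 2)⁻¹ := by
        rw [sq, mul_inv]
        have hb : 0 < 2 * Real.pi * β := by positivity
        exact mul_le_mul (inv_anti₀ hb (hdβ i)) (inv_anti₀ hb (hdβ j))
          (inv_nonneg.2 (hd0 j).le) (inv_nonneg.2 hb.le)
      rw [div_eq_mul_inv]
      calc (d i)⁻¹ * (F * (Γ - D) * Fᵀ) i j ^ 2 * (d j)⁻¹
          = (F * (Γ - D) * Fᵀ) i j ^ 2 * ((d i)⁻¹ * (d j)⁻¹) := by ring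
        _ ≤ _ := mul_le_mul_of_nonneg_left h6 (sq_nonneg _)
    rw [h1, sum_sq_conj hU1]
    calc ∑ i, ∑ j, (S - 1) i j ^ 2
        ≤ ∑ i, ∑ j, (F * (Γ - D) * Fᵀ) i j ^ 2 / (2 * Real.pi * β) ^ 2 :=
          Finset.sum_le_sum fun i _ => Finset.sum_le_sum fun j _ => h5 i j
      _ = (∑ i, ∑ j, (Γ - D) i j ^ 2) / (2 * Real.pi * β) ^ 2 := by
          rw [← sum_sq_conj hF1]
          simp only [Finset.sum_div]
      _ ≤ _ := by
          refine div_le_div_of_nonneg_right ?_ (sq_nonneg _)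
          refine le_trans (le_of_eq ?_) (sum_sq_sub_aliasedCov_le hs hs' n)
          refine Finset.sum_congr rfl fun s _ => Finset.sum_congr rfl fun t _ => ?_
          rw [Matrix.sub_apply, hDentry, hΓ, Matrix.of_apply]

lemma SpectralAssumption.spectralDensity_fourierFreq_pos {γ : ℤ → ℝ}
    (h : SpectralAssumption γ) {n j : ℕ} (hj : j ≤ n) : 0 < spectralDensity γ (fourierFreq n j) := by
  obtain ⟨β, hβ0, hβ⟩ := h.2
  exact hβ0.trans_le (le_spectralDensity_fourierFreq h.summable_abs hβ hj)

/-- A dimension-free comparison of the law of a stationary Gaussian series with its Whittle law. -/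
theorem exists_seriesLaw_whittleLaw_le_rpow {Ω : Type*} [MeasurableSpace Ω] {P : Measure Ω}
    [IsProbabilityMeasure P] {Z : ℕ → Ω → ℝ} {γ : ℤ → ℝ}
    (hZ : IsStationaryGaussianSeries P Z γ) (hγ : SpectralAssumption γ) :
    (∃ C : ℝ≥0∞, C ≠ ∞ ∧ ∃ θ : ℝ, 0 < θ ∧ ∀ (n : ℕ) (A : Set (Fin n → ℝ)), MeasurableSet A →
      seriesLaw P Z n A ≤ C * whittleLaw (spectralDensity γ) n A ^ θ) ∧
    (∃ C : ℝ≥0∞, C ≠ ∞ ∧ ∃ θ : ℝ, 0 < θ ∧ ∀ (n : ℕ) (A : Set (Fin n → ℝ)), MeasurableSet A →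
      whittleLaw (spectralDensity γ) n A ≤ C * seriesLaw P Z n A ^ θ) := by
  have hpi := Real.pi_pos
  have hs := hγ.summable_abs
  have hs' := hγ.summable_mul_abs
  obtain ⟨β, hβ0, hβ⟩ := hγ.2
  set G := ∑' k, |γ k| with hG
  have hG0 : 0 < G := by
    refine lt_of_lt_of_le ?_ (two_pi_mul_spectralDensity_le hs 0)
    exact mul_pos (by positivity) (hβ0.trans_le (hβ 0 ⟨by linarith, hpi.le⟩))
  set a := 2 * Real.pi * β / G with ha
  have ha0 : 0 < a := by positivity
  set K := G * (∑' k : ℤ, |(k : ℝ)| * |γ k|) / (2 * Real.pi * β) ^ 2 with hK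
  have hK0 : 0 ≤ K := by
    have : 0 ≤ ∑' k : ℤ, |(k : ℝ)| * |γ k| := tsum_nonneg fun k => by positivity
    positivity
  choose U B l hU hB hL hal hlK using
    exists_simultaneous_diagonalization hs hs' hZ.even hβ0 hβ
  set L := fun n => U n * whiteningMatrix (spectralDensity γ) n with hLdef
  have hBL : ∀ n, L n * B n = 1 := hB
  have hl0 : ∀ n i, 0 < l n i := fun n i => ha0.trans_le (hal n i)
  have hser : ∀ n, (seriesLaw P Z n).map (fun z => L n *ᵥ z)
      = Measure.pi fun i => gaussianReal 0 (l n i).toNNReal := fun n => hZ.map_seriesLaw (hL n)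
  have hwhi : ∀ n, (whittleLaw (spectralDensity γ) n).map (fun z => L n *ᵥ z)
      = Measure.pi fun _ => gaussianReal 0 (1 : ℝ).toNNReal := fun n => by
    rw [Real.toNNReal_one]
    exact map_whittleLaw (spectralDensity_two_pi_sub hs) (fun j hj => hγ.spectralDensity_fourierFreq_pos hj)
      (hU n) (hB n)
  -- `B n` inverts `L n`, so every event can be moved to the diagonalizing coordinates without
  -- changing its probability.
  have hpre : ∀ (n : ℕ) (R : Measure (Fin n → ℝ)) (A : Set (Fin n → ℝ)), MeasurableSet A →
      R.map (fun z => L n *ᵥ z) ((fun z => B n *ᵥ z) ⁻¹' A) = R A := by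
    intro n R A hA
    rw [Measure.map_apply (measurable_mulVec_const _) (measurable_mulVec_const _ hA),
      ← Set.preimage_comp]
    congr 1
    ext x
    simp [mul_eq_one_comm.1 (hBL n)]
  constructor
  · obtain ⟨C, hC, θ, hθ, h⟩ := exists_pi_gaussianReal_le_rpow (K := K) ha0
    refine ⟨C, hC, θ, hθ, fun n A hA => ?_⟩
    rw [← hpre n _ A hA, ← hpre n (whittleLaw _ n) A hA, hser, hwhi]
    refine h n (l n) (fun _ => 1) (hl0 n) (fun _ => one_pos) (fun i => by simpa using hal n i) ?_ _
      (measurable_mulVec_const _ hA)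
    simpa using hlK n
  -- The ratios are now `1 / l`. From `(l - 1)² ≤ K` follows `l ≤ K + 2`, and `|1/l - 1| = |l - 1| /
  -- l ≤ |l - 1| / a`.
  · obtain ⟨C, hC, θ, hθ, h⟩ := exists_pi_gaussianReal_le_rpow (a := 1 / (K + 2)) (K := K / a ^ 2)
      (by positivity)
    refine ⟨C, hC, θ, hθ, fun n A hA => ?_⟩
    rw [← hpre n _ A hA, ← hpre n (seriesLaw P Z n) A hA, hser, hwhi]
    refine h n (fun _ => 1) (l n) (fun _ => one_pos) (hl0 n) (fun i => ?_) ?_ _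
      (measurable_mulVec_const _ hA)
    · have h1 : (l n i - 1) ^ 2 ≤ K :=
        (Finset.single_le_sum (f := fun i => (l n i - 1) ^ 2) (fun i _ => sq_nonneg _)
          (Finset.mem_univ i)).trans (hlK n)
      exact one_div_le_one_div_of_le (hl0 n i) (by nlinarith)
    · calc ∑ i, (1 / l n i - 1) ^ 2 ≤ ∑ i, (l n i - 1) ^ 2 / a ^ 2 := by
            refine Finset.sum_le_sum fun i _ => ?_
            have h1 : (1 / l n i - 1) ^ 2 = (l n i - 1) ^ 2 / l n i ^ 2 := by
              have := (hl0 n i).ne'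
              field_simp
              ring
            rw [h1]
            exact div_le_div_of_nonneg_left (sq_nonneg _) (by positivity)
              (pow_le_pow_left₀ ha0.le (hal n i) 2)
        _ = (∑ i, (l n i - 1) ^ 2) / a ^ 2 := by rw [Finset.sum_div]
        _ ≤ K / a ^ 2 := div_le_div_of_nonneg_right (hlK n) (sq_nonneg _)

theorem mutuallyContiguous_seriesLaw_whittleLaw {Ω : Type*} [MeasurableSpace Ω] {P : Measure Ω}
    [IsProbabilityMeasure P] {Z : ℕ → Ω → ℝ} {γ : ℤ → ℝ}
    (hZ : IsStationaryGaussianSeries P Z γ) (hγ : SpectralAssumption γ) :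
    MutuallyContiguous (fun n => seriesLaw P Z n)
      (fun n => whittleLaw (spectralDensity γ) n) := by
  obtain ⟨⟨C, hC, θ, hθ, h⟩, ⟨C', hC', θ', hθ', h'⟩⟩ := exists_seriesLaw_whittleLaw_le_rpow hZ hγ
  exact ⟨contiguous_of_le_rpow hC' hθ' (Eventually.of_forall h'),
    contiguous_of_le_rpow hC hθ (Eventually.of_forall h)⟩

/-- The power bound carries null sets of the Whittle law to null sets of the series law. This makes
the Radon–Nikodym derivative in `seriesDensity` a genuine density. -/
lemma seriesLaw_absolutelyContinuous {Ω : Type*} [MeasurableSpace Ω] {P : Measure Ω}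
    [IsProbabilityMeasure P] {Z : ℕ → Ω → ℝ} {γ : ℤ → ℝ}
    (hZ : IsStationaryGaussianSeries P Z γ) (hγ : SpectralAssumption γ) (n : ℕ) :
    seriesLaw P Z n ≪ volume := by
  obtain ⟨⟨C, hC, θ, hθ, h⟩, -⟩ := exists_seriesLaw_whittleLaw_le_rpow hZ hγ
  refine Measure.AbsolutelyContinuous.mk fun A hA hA0 => ?_
  have := h n A hA
  rw [whittleLaw_absolutelyContinuous _ n hA0, ENNReal.zero_rpow_of_pos hθ, mul_zero] at this
  exact le_antisymm this zero_le

/-! ### The corrected law -/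

/-- The matrix `F_nᵀ C_n^{-1/2} F_n`. -/
noncomputable def correctionTransform (f fparam : ℝ → ℝ) (n : ℕ) : Matrix (Fin n) (Fin n) ℝ :=
  (fourierMatrix n)ᵀ * correctionInvSqrt (fun x => f x / fparam x) n * fourierMatrix n

lemma exists_mul_correctionTransform_eq_one {f fparam : ℝ → ℝ} {n : ℕ}
    (hf : ∀ j ≤ n, 0 < f (fourierFreq n j)) (hfp : ∀ j ≤ n, 0 < fparam (fourierFreq n j)) :
    ∃ B, B * correctionTransform f fparam n = 1 := by
  set c := freqDiag (fun x => f x / fparam x) n with hc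
  have hc0 : ∀ i, 0 < c i :=
    freqDiag_pos (f := fun x => f x / fparam x) fun j hj => div_pos (hf j hj) (hfp j hj)
  set F := fourierMatrix n with hF
  refine ⟨Fᵀ * Matrix.diagonal (fun i => (c i ^ (-(1 / 2) : ℝ))⁻¹) * F, ?_⟩
  calc Fᵀ * Matrix.diagonal (fun i => (c i ^ (-(1 / 2) : ℝ))⁻¹) * F
        * (Fᵀ * Matrix.diagonal (fun i => c i ^ (-(1 / 2) : ℝ)) * F)
      = Fᵀ * (Matrix.diagonal (fun i => (c i ^ (-(1 / 2) : ℝ))⁻¹) * (F * Fᵀ)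
        * Matrix.diagonal (fun i => c i ^ (-(1 / 2) : ℝ))) * F := by
        simp only [Matrix.mul_assoc]
    _ = 1 := by
        rw [hF, fourierMatrix_mul_transpose_self, Matrix.mul_one, Matrix.diagonal_mul_diagonal]
        have : (fun i => (c i ^ (-(1 / 2) : ℝ))⁻¹ * c i ^ (-(1 / 2) : ℝ)) = fun _ => 1 := by
          ext i
          exact inv_mul_cancel₀ (Real.rpow_pos_of_pos (hc0 i) _).ne'
        rw [this, Matrix.diagonal_one, Matrix.mul_one, fourierMatrix_transpose_mul_self]

/-- The diagonal factors in the Fourier basis multiply as `(2πf_param)^{-1/2} (f/f_param)^{-1/2} =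
(2πf)^{-1/2}`. -/
lemma whiteningMatrix_mul_correctionTransform {f fparam : ℝ → ℝ} {n : ℕ}
    (hf : ∀ j ≤ n, 0 < f (fourierFreq n j)) (hfp : ∀ j ≤ n, 0 < fparam (fourierFreq n j)) :
    whiteningMatrix fparam n * correctionTransform f fparam n = whiteningMatrix f n := by
  have h : whiteningMatrix fparam n * correctionTransform f fparam n
      = Matrix.diagonal (fun i => (√(freqDiag (fun x => 2 * Real.pi * fparam x) n i))⁻¹)
        * (fourierMatrix n * (fourierMatrix n)ᵀ)
        * correctionInvSqrt (fun x => f x / fparam x) n * fourierMatrix n := by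
    rw [whiteningMatrix, correctionTransform]
    simp only [Matrix.mul_assoc]
  rw [h, fourierMatrix_mul_transpose_self, Matrix.mul_one, correctionInvSqrt,
    Matrix.diagonal_mul_diagonal, whiteningMatrix]
  congr 2
  ext i
  have h1 := freqDiag_pos hf i
  have h2 := freqDiag_pos hfp i
  change (√(2 * Real.pi * freqDiag fparam n i))⁻¹
    * (freqDiag f n i / freqDiag fparam n i) ^ (-(1 / 2) : ℝ)
    = (√(2 * Real.pi * freqDiag f n i))⁻¹
  rw [Real.rpow_neg (by positivity), ← Real.sqrt_eq_rpow, ← mul_inv,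
    ← Real.sqrt_mul (by positivity)]
  congr 2
  field_simp

lemma map_correctionTransform_whittleLaw {f fparam : ℝ → ℝ} {n : ℕ}
    (hfs : ∀ x, f (2 * Real.pi - x) = f x) (hfps : ∀ x, fparam (2 * Real.pi - x) = fparam x)
    (hf : ∀ j ≤ n, 0 < f (fourierFreq n j)) (hfp : ∀ j ≤ n, 0 < fparam (fourierFreq n j)) :
    (whittleLaw f n).map (fun z => correctionTransform f fparam n *ᵥ z)
      = whittleLaw fparam n := by
  obtain ⟨B, hB⟩ := exists_mul_correctionTransform_eq_one hf hfp
  have hm : Measurable fun z : Fin n → ℝ => gaussianKernel (whiteningMatrix fparam n *ᵥ z) :=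
    measurable_gaussianKernel.comp (measurable_mulVec_const _)
  rw [whittleLaw_eq hfs hf, whittleLaw_eq hfps hfp,
    ← map_normalizedLaw_mulVec (mul_eq_one_comm.1 hB) one_ne_zero ENNReal.one_ne_top hm]
  congr 2
  ext z
  rw [one_mul, Matrix.mulVec_mulVec,
    whiteningMatrix_mul_correctionTransform hf hfp]

/-- The determinant factor is a positive constant, absorbed by the normalization. -/
lemma map_correctionTransform_correctedLaw {f fparam : ℝ → ℝ} {n : ℕ}
    (hf : ∀ j ≤ n, 0 < f (fourierFreq n j)) (hfp : ∀ j ≤ n, 0 < fparam (fourierFreq n j))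
    {p : (Fin n → ℝ) → ℝ≥0∞} (hp : Measurable p) :
    (correctedLaw f fparam n p).map (fun z => correctionTransform f fparam n *ᵥ z)
      = normalizedLaw p := by
  obtain ⟨B, hB⟩ := exists_mul_correctionTransform_eq_one hf hfp
  have hdet : 0 < (correctionMatrix (fun x => f x / fparam x) n).det := by
    rw [correctionMatrix, Matrix.det_diagonal]
    exact Finset.prod_pos fun i _ =>
      freqDiag_pos (f := fun x => f x / fparam x) (fun j hj => div_pos (hf j hj) (hfp j hj)) i
  exact map_normalizedLaw_mulVec (mul_eq_one_comm.1 hB)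
    (by simpa using Real.rpow_pos_of_pos hdet _) ENNReal.ofReal_ne_top hp

theorem mutuallyContiguous_whittleLaw_correctedLaw {Ω : Type*} [MeasurableSpace Ω]
    {P : Measure Ω} [IsProbabilityMeasure P] {Y : ℕ → Ω → ℝ} {γ₀ γparam : ℤ → ℝ}
    (hY : IsStationaryGaussianSeries P Y γparam) (hγparam : SpectralAssumption γparam)
    (hγ₀ : SpectralAssumption γ₀) :
    MutuallyContiguous (fun n => whittleLaw (spectralDensity γ₀) n)
      (fun n => correctedLaw (spectralDensity γ₀) (spectralDensity γparam) n
        (seriesDensity P Y n)) := by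
  have hf : ∀ n : ℕ, ∀ j ≤ n, 0 < spectralDensity γ₀ (fourierFreq n j) :=
    fun n j hj => hγ₀.spectralDensity_fourierFreq_pos hj
  have hfp : ∀ n : ℕ, ∀ j ≤ n, 0 < spectralDensity γparam (fourierFreq n j) :=
    fun n j hj => hγparam.spectralDensity_fourierFreq_pos hj
  choose B hB using fun n => exists_mul_correctionTransform_eq_one (hf n) (hfp n)
  have hW : ∀ n, whittleLaw (spectralDensity γparam) n = (whittleLaw (spectralDensity γ₀) n).map
      (fun z => correctionTransform (spectralDensity γ₀) (spectralDensity γparam) n *ᵥ z) :=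
    fun n => (map_correctionTransform_whittleLaw (spectralDensity_two_pi_sub hγ₀.summable_abs)
      (spectralDensity_two_pi_sub hγparam.summable_abs) (hf n) (hfp n)).symm
  have hC : ∀ n, seriesLaw P Y n = (correctedLaw (spectralDensity γ₀) (spectralDensity γparam) n
      (seriesDensity P Y n)).map
      (fun z => correctionTransform (spectralDensity γ₀) (spectralDensity γparam) n *ᵥ z) := by
    intro n
    have hprob : IsProbabilityMeasure (seriesLaw P Y n) :=
      Measure.isProbabilityMeasure_map (hY.hasGaussianLaw n).aemeasurable
    have hm : Measurable (seriesDensity P Y n) := Measure.measurable_rnDeriv _ _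
    rw [map_correctionTransform_correctedLaw (hf n) (hfp n) hm]
    exact (normalizedLaw_of_withDensity_eq (Measure.withDensity_rnDeriv_eq _ _
      (seriesLaw_absolutelyContinuous hY hγparam n))).symm
  have hBinv : ∀ n (x : Fin n → ℝ), B n *ᵥ
      (correctionTransform (spectralDensity γ₀) (spectralDensity γparam) n *ᵥ x) = x := by
    intro n x
    rw [Matrix.mulVec_mulVec, hB, Matrix.one_mulVec]
  have hparam := mutuallyContiguous_seriesLaw_whittleLaw hY hγparam
  exact ⟨Contiguous.of_map hC hW (fun n => measurable_mulVec_const _)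
      (fun n => measurable_mulVec_const (B n)) hBinv hparam.2,
    Contiguous.of_map hW hC (fun n => measurable_mulVec_const _)
      (fun n => measurable_mulVec_const (B n)) hBinv hparam.1⟩

end Whittle

theorem mainTheorem2
    {Ω Ω' : Type*} [MeasurableSpace Ω] [MeasurableSpace Ω']
    (P : Measure Ω) [IsProbabilityMeasure P] (P' : Measure Ω') [IsProbabilityMeasure P']
    (Z : ℕ → Ω → ℝ) (γ₀ : ℤ → ℝ) (Y : ℕ → Ω' → ℝ) (γparam : ℤ → ℝ)
    (hY : Whittle.IsStationaryGaussianSeries P' Y γparam)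
    (hγparam : Whittle.SpectralAssumption γparam)
    (hZ : Whittle.IsStationaryGaussianSeries P Z γ₀)
    (hγ₀ : Whittle.SpectralAssumption γ₀) :
    Whittle.MutuallyContiguous
      (fun n => Whittle.seriesLaw P Z n)
      (fun n => Whittle.whittleLaw (Whittle.spectralDensity γ₀) n) ∧
    Whittle.MutuallyContiguous
      (fun n => Whittle.whittleLaw (Whittle.spectralDensity γ₀) n)
      (fun n => Whittle.correctedLaw (Whittle.spectralDensity γ₀)
        (Whittle.spectralDensity γparam) n (Whittle.seriesDensity P' Y n)) ∧
    Whittle.MutuallyContiguous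
      (fun n => Whittle.seriesLaw P Z n)
      (fun n => Whittle.correctedLaw (Whittle.spectralDensity γ₀)
        (Whittle.spectralDensity γparam) n (Whittle.seriesDensity P' Y n)) := by
  have h₁ := Whittle.mutuallyContiguous_seriesLaw_whittleLaw hZ hγ₀
  have h₂ := Whittle.mutuallyContiguous_whittleLaw_correctedLaw hY hγparam hγ₀
  exact ⟨h₁, h₂, h₁.trans h₂⟩
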